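/- Let $A=(a_{ij})_{1\le i,j\le \ell}$ be a symmetrizable generalized Cartan matrix, let $(\mathfrak h,\{\alpha_i\},\{\alpha_i^\vee\})$ be a realization of $A$ over $\mathbb C$, and let $\mathfrak g=\mathfrak g(A)$ be the Kac–Moody algebra, i.e. the complex Lie algebra generated by the vector space $\mathfrak h$ and elements $e_i,f_i$ with relations $[h,h']=0$, $[h,e_i]=\alpha_i(h)e_i$, $[h,f_i]=-\alpha_i(h)f_i$, $[e_i,f_i]=\alpha_i^\vee$, and, for $i\neq j$, $[e_i,f_j]=0$, $(\operatorname{ad}e_i)^{1-a_{ij}}e_j=0$, $(\operatorname{ad}f_i)^{1-a_{ij}}f_j=0$. Let $\Delta=\Delta^+\sqcup\Delta^-$ be the set of roots (positive and negative). Let $P\subseteq\mathfrak h^*$ be a restricted weight lattice, i.e. a subgroup that contains all $\alpha_i$, takes integer values on all $\alpha_i^\vee$, and has a $\mathbb Z$-basis $\omega_1,\dots,\omega_\ell,\dots,\omega_d$ that is also a $\mathbb C$-basis of $\mathfrak h^*$, with $\omega_i(\alpha_j^\vee)=\delta_{ij}$ for $i,j\le\ell$. Let $V$ be a standard graded $\mathfrak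 g$-module, with action $\rho$: $V$ is the direct sum of its weight spaces $V_\mu$, these are finite dimensional, all weights of $V$ lie in $P$, and there is given an additive map $f:P\to\mathbb Z$ such that, with $\Delta_m=\{\alpha\in\Delta\cup\{0\}: f(\alpha)=m\}$ and $\mathrm{wts}_m(V)=\{\mu \text{ a weight of } V: f(\mu)=m\}$, for every $m\in\mathbb Z$: $\Delta_m$ and $\mathrm{wts}_m(V)$ are finite; $\Delta_m\subseteq\Delta^+$ if $m>0$, $\Delta_0=\{0\}$, $\Delta_m\subseteq\Delta^-$ if $m<0$; and distinct elements of $\mathrm{wts}_m(V)$ are incomparable in the order $\mu\le\nu\iff\nu-\mu\in\sum_i\mathbb Z_{\ge0}\alpha_i$. Put $\mathfrak g_m=\bigoplus_{\alpha\in\Delta_m}\mathfrak g_\alpha$, $V_m=\bigoplus_{\mu\in \mathrm{wts}_m(V)}V_\mu$ and $$\widehat V=\bigoplus_{m<0}V_m\oplus\prod_{m\ge0}V_m,\qquad \widehat{\mathfrak n}^+_n=\prod_{k\ge n}\mathfrak g_k\quad(n\ge1).$$ Give $\widehat{\mathfrak n}^+_n$ the product topology and $\widehat V$ the subspace topology of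 $\prod_m V_m$, where $\mathfrak g_k$ and $V_m$ carry their topologies as finite-dimensional complex vector spaces. Give the group $\mathrm{GL}(\widehat V)$ of all linear automorphisms of $\widehat V$ the topology of pointwise convergence. Extend $\rho$ to the completions: for $x=\sum_{k\ge1}x_k\in\widehat{\mathfrak n}^+_1$ and $v=\sum_m v_m\in\widehat V$, the degree $m$ component of $\rho(x)v$ is the finite sum $\sum_k x_k\cdot v_{m-k}$. Then $\exp(\rho(x))=\sum_{j\ge0}\rho(x)^j/j!$, a finite sum in each degree when applied to an element of $\widehat V$, belongs to $\mathrm{GL}(\widehat V)$. Infinite products are read from right to left: $$\prod_{k=n}^\infty\exp(\rho(x_k))=\lim_{N\to\infty}\exp(\rho(x_N))\cdots\exp(\rho(x_{n+1}))\exp(\rho(x_n))\quad\text{in }\mathrm{GL}(\widehat V).$$ Let $\widehat U^+_{V,n}=\{\prod_{k=n}^\infty\exp(\rho(x_k)) : x_k\in\mathfrak g_k\}\subseteq\mathrm{GL}(\widehat V)$, with the subspace topology. **Lemma.** If $V$ is faithful (that is, $\rho:\mathfrak g\to\mathfrak{gl}(V)$ is injective), then for every integer $n\ge1$ the maps $$x\mapsto\exp(\rho(x))\qquad\text{and}\qquad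 x=\sum_{k=n}^\infty x_k\mapsto\prod_{k=n}^\infty\exp(\rho(x_k))$$ are both (well defined and) homeomorphisms from $\widehat{\mathfrak n}^+_n$ onto $\widehat U^+_{V,n}$. -/

import Mathlib

open Topology Filter

/-! ### Generalized Cartan matrices and their realizations -/

/-- Generalized Cartan matrices. -/
structure IsGCM {l : ℕ} (A : Matrix (Fin l) (Fin l) ℤ) : Prop where
  diag : ∀ i, A i i = 2
  nonpos : ∀ i j, i ≠ j → A i j ≤ 0
  zero_symm : ∀ i j, A i j = 0 → A j i = 0

/-- `A` is symmetrizable: `diag(d) A` is symmetric for some positive rationals `d i`. -/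
def IsSymmetrizable {l : ℕ} (A : Matrix (Fin l) (Fin l) ℤ) : Prop :=
  ∃ d : Fin l → ℚ, (∀ i, 0 < d i) ∧
    (Matrix.diagonal d * A.map (fun z : ℤ => (z : ℚ))).IsSymm

/-- A realization `(h, Π, Π^∨)` of the matrix `A` over `ℂ`. -/
structure Realization {l : ℕ} (A : Matrix (Fin l) (Fin l) ℤ)
    (h : Type*) [AddCommGroup h] [Module ℂ h] where
  /-- the simple roots -/
  root : Fin l → Module.Dual ℂ h
  /-- the simple coroots -/
  coroot : Fin l → h
  finite : Module.Finite ℂ h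
  dim : Module.finrank ℂ h + (A.map (fun z : ℤ => (z : ℂ))).rank = 2 * l
  root_indep : LinearIndependent ℂ root
  coroot_indep : LinearIndependent ℂ coroot
  pairing : ∀ i j, root j (coroot i) = (A i j : ℂ)

/-! ### The Kac--Moody algebra -/

/-- The generators `h ∪ {e_i, f_i}`. -/
inductive KMGen (l : ℕ) (h : Type*) where
  | H : h → KMGen l h
  | E : Fin l → KMGen l h
  | F : Fin l → KMGen l h

namespace KacMoody

variable {l : ℕ} {A : Matrix (Fin l) (Fin l) ℤ} {h : Type*} [AddCommGroup h] [Module ℂ h]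

/-- The free Lie algebra on the generators. -/
abbrev FreeKM (l : ℕ) (h : Type*) := FreeLieAlgebra ℂ (KMGen l h)

/-- The generator of the free Lie algebra given by an element of `h`. -/
noncomputable def fH (l : ℕ) {h : Type*} (x : h) : FreeKM l h := FreeLieAlgebra.of ℂ (KMGen.H x)

/-- The generator `e_i` of the free Lie algebra. -/
noncomputable def fE {l : ℕ} (h : Type*) (i : Fin l) : FreeKM l h :=
  FreeLieAlgebra.of ℂ (KMGen.E i)

/-- The generator `f_i` of the free Lie algebra. -/
noncomputable def fF {l : ℕ} (h : Type*) (i : Fin l) : FreeKM l h :=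
  FreeLieAlgebra.of ℂ (KMGen.F i)

/-- The defining relations, written as elements that are set to zero. The first two say that `h`
enters as a vector space; the others are the Chevalley--Serre relations. -/
inductive Rel (R : Realization A h) : FreeKM l h → Prop
  | add (x y : h) : Rel R (fH l (x + y) - (fH l x + fH l y))
  | smul (c : ℂ) (x : h) : Rel R (fH l (c • x) - c • fH l x)
  | hh (x y : h) : Rel R ⁅fH l x, fH l y⁆
  | he (x : h) (i : Fin l) : Rel R (⁅fH l x, fE h i⁆ - R.root i x • fE h i)
  | hf (x : h) (i : Fin l) : Rel R (⁅fH l x, fF h i⁆ + R.root i x • fF h i)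
  | ef_same (i : Fin l) : Rel R (⁅fE h i, fF h i⁆ - fH l (R.coroot i))
  | ef_ne (i j : Fin l) : i ≠ j → Rel R ⁅fE h i, fF h j⁆
  | serre_e (i j : Fin l) : i ≠ j →
      Rel R (((LieAlgebra.ad ℂ (FreeKM l h) (fE h i)) ^ (1 - A i j).toNat) (fE h j))
  | serre_f (i j : Fin l) : i ≠ j →
      Rel R (((LieAlgebra.ad ℂ (FreeKM l h) (fF h i)) ^ (1 - A i j).toNat) (fF h j))

/-- The ideal generated by the defining relations. -/
noncomputable def relIdeal (R : Realization A h) : LieIdeal ℂ (FreeKM l h) :=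
  LieSubmodule.lieSpan ℂ (FreeKM l h) {x | Rel R x}

/-- The Kac--Moody algebra `g = g(A)` of a realization. -/
def KMAlg (R : Realization A h) : Type _ := FreeKM l h ⧸ relIdeal R

noncomputable instance (R : Realization A h) : LieRing (KMAlg R) :=
  inferInstanceAs (LieRing (FreeKM l h ⧸ relIdeal R))

noncomputable instance (R : Realization A h) : LieAlgebra ℂ (KMAlg R) :=
  inferInstanceAs (LieAlgebra ℂ (FreeKM l h ⧸ relIdeal R))

/-- The image in `g` of an element of `h`. -/
noncomputable def cartan (R : Realization A h) (x : h) : KMAlg R :=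
  LieSubmodule.Quotient.mk (N := relIdeal R) (fH l x)

/-! ### Weights and roots -/

section Weights

variable (R : Realization A h) (V : Type*) [AddCommGroup V] [Module ℂ V]
  [LieRingModule (KMAlg R) V] [LieModule ℂ (KMAlg R) V]

/-- The weight space `V_μ`. For the adjoint module `V = g` this is the root space `g_μ`. -/
def wtSpace (μ : Module.Dual ℂ h) : Submodule ℂ V where
  carrier := {v | ∀ x : h, ⁅cartan R x, v⁆ = μ x • v}
  add_mem' := by
    intro a b ha hb x
    rw [lie_add, ha x, hb x, smul_add]
  zero_mem' := by
    intro x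
    simp
  smul_mem' := by
    intro c v hv x
    rw [lie_smul, hv x, smul_comm]

/-- The set of weights of `V`. -/
def wts : Set (Module.Dual ℂ h) := {μ | wtSpace R V μ ≠ ⊥}

/-- `V` is a weight module: it is the sum (automatically direct) of its weight spaces, and these
are finite dimensional. -/
structure IsWeightModule : Prop where
  diagonalizable : (⨆ μ, wtSpace R V μ) = ⊤
  finite : ∀ μ, Module.Finite ℂ (wtSpace R V μ)

/-- The set `Δ` of roots. -/
def roots : Set (Module.Dual ℂ h) := {α | α ≠ 0 ∧ wtSpace R (KMAlg R) α ≠ ⊥}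

/-- `Q^+`, the set of combinations of simple roots with natural number coefficients. -/
def posCone : Set (Module.Dual ℂ h) := {β | ∃ k : Fin l → ℕ, β = ∑ i, k i • R.root i}

/-- The set `Δ^+` of positive roots. -/
def posRoots : Set (Module.Dual ℂ h) := {α | α ∈ roots R ∧ α ∈ posCone R}

/-- The set `Δ^-` of negative roots. -/
def negRoots : Set (Module.Dual ℂ h) := {α | α ∈ roots R ∧ -α ∈ posCone R}

/-- The dominance order on `h^*`. -/
def domLE (μ ν : Module.Dual ℂ h) : Prop := ν - μ ∈ posCone R

/-- `P` is a restricted weight lattice: it contains the root lattice, is integral on the simple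
coroots, and has a `ℤ`-basis which is a `ℂ`-basis of `h^*` extending a set of fundamental weights.
The minimal regular weight in the usual definition, a weight that takes the value `1` on all simple
coroots, is then the sum of the fundamental weights. -/
structure IsRestrictedWeightLattice (P : AddSubgroup (Module.Dual ℂ h)) : Prop where
  root_mem : ∀ i, R.root i ∈ P
  integral : ∀ μ ∈ P, ∀ i, ∃ z : ℤ, μ (R.coroot i) = (z : ℂ)
  basis : ∃ (r : ℕ) (ω : Module.Basis (Fin l ⊕ Fin r) ℂ (Module.Dual ℂ h)),
    (∀ i j, ω (Sum.inl i) (R.coroot j) = if i = j then 1 else 0) ∧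
    P = AddSubgroup.closure (Set.range ω)

/-- For `f : P → ℤ` and a set `S` of weights, the weights in `S` of degree `m`. -/
def degSet {P : AddSubgroup (Module.Dual ℂ h)} (f : P →+ ℤ) (S : Set (Module.Dual ℂ h)) (m : ℤ) :
    Set (Module.Dual ℂ h) :=
  {μ | μ ∈ S ∧ ∃ hμ : μ ∈ P, f ⟨μ, hμ⟩ = m}

/-- A structure of standard graded module on the `g`-module `V`: `V` is a weight module with all
weights in `P`, and `f : P → ℤ` is a grading function satisfying (F1)--(F4). -/
structure StdGrading (P : AddSubgroup (Module.Dual ℂ h)) where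
  isWeightModule : IsWeightModule R V
  wts_subset : wts R V ⊆ P
  /-- the grading function; (F1) it is additive -/
  f : P →+ ℤ
  /-- (F2) for the roots -/
  finite_roots : ∀ m, (degSet f (roots R ∪ {0}) m).Finite
  /-- (F2) for the weights -/
  finite_wts : ∀ m, (degSet f (wts R V) m).Finite
  /-- (F3) in positive degree -/
  deg_pos : ∀ m, 0 < m → degSet f (roots R ∪ {0}) m ⊆ posRoots R
  /-- (F3) in degree zero -/
  deg_zero : degSet f (roots R ∪ {0}) 0 = {0}
  /-- (F3) in negative degree -/
  deg_neg : ∀ m, m < 0 → degSet f (roots R ∪ {0}) m ⊆ negRoots R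
  /-- (F4) -/
  incomparable : ∀ m, ∀ μ ∈ degSet f (wts R V) m, ∀ ν ∈ degSet f (wts R V) m,
    domLE R μ ν → μ = ν

end Weights

/-! ### Positive completions of graded spaces -/

section Completion

variable {M : Type*} [AddCommGroup M] [Module ℂ M]

/-- The positive completion `⨁_{m<0} W_m ⊕ ∏_{m≥0} W_m`, as the space of families
`(w_m)_{m ∈ ℤ}` that vanish for all sufficiently small `m`. -/
def PosCompletion (W : ℤ → Submodule ℂ M) : Submodule ℂ (∀ m, W m) where
  carrier := {v | ∃ N : ℤ, ∀ m < N, v m = 0}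
  add_mem' := by
    rintro a b ⟨N, hN⟩ ⟨K, hK⟩
    refine ⟨min N K, fun m hm => ?_⟩
    rw [Pi.add_apply, hN m (lt_of_lt_of_le hm (min_le_left _ _)),
      hK m (lt_of_lt_of_le hm (min_le_right _ _)), add_zero]
  zero_mem' := ⟨0, fun _ _ => rfl⟩
  smul_mem' := by
    rintro c v ⟨N, hN⟩
    exact ⟨N, fun m hm => by rw [Pi.smul_apply, hN m hm, smul_zero]⟩

/-- The topology on the completion: the subspace topology of the product `∏_m W_m`, where each
`W_m` carries its topology as a `ℂ`-vector space. (The module topology is the usual topology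
if `W_m` is finite dimensional.) -/
noncomputable instance posCompletionTopology (W : ℤ → Submodule ℂ M) : TopologicalSpace (PosCompletion W) :=
  TopologicalSpace.induced (fun v : PosCompletion W => v.1)
    (@Pi.topologicalSpace ℤ (fun m => W m) (fun m => moduleTopology ℂ (W m)))

/-- The topology of pointwise convergence on the group `GL` of all linear automorphisms of the
completion. -/
noncomputable instance glTopology (W : ℤ → Submodule ℂ M) :
    TopologicalSpace (PosCompletion W ≃ₗ[ℂ] PosCompletion W) :=
  TopologicalSpace.induced (fun g v => g v) inferInstance

variable {W : ℤ → Submodule ℂ M}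

/-- `v` has no components in degrees below `k`. -/
def OrdGE (k : ℤ) (v : PosCompletion W) : Prop := ∀ m < k, v.1 m = 0

/-- An operator that raises the order by at least one. -/
def Raises (T : Module.End ℂ (PosCompletion W)) : Prop :=
  ∀ k v, OrdGE k v → OrdGE (k + 1) (T v)

theorem OrdGE.mono {k k' : ℤ} {v : PosCompletion W} (hv : OrdGE k v) (hk : k' ≤ k) :
    OrdGE k' v :=
  fun m hm => hv m (lt_of_lt_of_le hm hk)

theorem Raises.pow {T : Module.End ℂ (PosCompletion W)} (hT : Raises T) {k : ℤ}
    {v : PosCompletion W} (hv : OrdGE k v) (j : ℕ) : OrdGE (k + j) ((T ^ j) v) := by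
  induction j with
  | zero => simpa using hv
  | succ j ih =>
    rw [pow_succ', Module.End.mul_apply]
    have := hT _ _ ih
    push_cast
    rwa [← add_assoc]

theorem Raises.finite {T : Module.End ℂ (PosCompletion W)} (hT : Raises T) (c : ℕ → ℂ)
    (v : PosCompletion W) (m : ℤ) :
    (Function.support fun j : ℕ => c j • ((T ^ j) v).1 m).Finite := by
  obtain ⟨N, hN⟩ := v.2
  refine (Set.finite_lt_nat ((m - N).toNat + 1)).subset fun j hj => ?_
  by_contra hlt
  refine hj ?_
  have hlt' : (m - N).toNat + 1 ≤ j := not_lt.mp hlt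
  have : ((T ^ j) v).1 m = 0 := hT.pow (k := N) hN j m (by omega)
  simp [this]

/-- The pro-summable series `∑_j c_j T^j` of an operator `T` that raises the order; each component
of the result is a finite sum. -/
noncomputable def proSeries (c : ℕ → ℂ) (T : Module.End ℂ (PosCompletion W)) (hT : Raises T) :
    Module.End ℂ (PosCompletion W) where
  toFun v := ⟨fun m => ∑ᶠ j : ℕ, c j • ((T ^ j) v).1 m, by
    obtain ⟨N, hN⟩ := v.2
    refine ⟨N, fun m hm => finsum_eq_zero_of_forall_eq_zero fun j => ?_⟩
    have : ((T ^ j) v).1 m = 0 := hT.pow (k := N) hN j m (by omega)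
    simp [this]⟩
  map_add' u v := by
    apply Subtype.ext
    funext m
    change (∑ᶠ j : ℕ, c j • ((T ^ j) (u + v)).1 m) =
      (∑ᶠ j : ℕ, c j • ((T ^ j) u).1 m) + ∑ᶠ j : ℕ, c j • ((T ^ j) v).1 m
    rw [← finsum_add_distrib (hT.finite c u m) (hT.finite c v m)]
    refine finsum_congr fun j => ?_
    rw [map_add, ← smul_add]
    rfl
  map_smul' a v := by
    apply Subtype.ext
    funext m
    change (∑ᶠ j : ℕ, c j • ((T ^ j) (a • v)).1 m) = a • ∑ᶠ j : ℕ, c j • ((T ^ j) v).1 m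
    rw [smul_finsum]
    refine finsum_congr fun j => ?_
    rw [map_smul, smul_comm]
    rfl

theorem proSeries_apply (c : ℕ → ℂ) (T : Module.End ℂ (PosCompletion W)) (hT : Raises T)
    (v : PosCompletion W) (m : ℤ) :
    (proSeries c T hT v).1 m = ∑ᶠ j : ℕ, c j • ((T ^ j) v).1 m := rfl

theorem proSeries_ordGE_sub (c : ℕ → ℂ) (T : Module.End ℂ (PosCompletion W)) (hT : Raises T)
    {k : ℤ} {v : PosCompletion W} (hv : OrdGE k v) (J : ℕ) :
    OrdGE (k + J) (proSeries c T hT v - ∑ j ∈ Finset.range J, c j • (T ^ j) v) := by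
  intro m hm
  have hs : (Function.support fun j : ℕ => c j • ((T ^ j) v).1 m) ⊆ (Finset.range J : Set ℕ) := by
    intro j hj
    by_contra hlt
    refine hj ?_
    have hlt' : J ≤ j := by simpa using hlt
    have : ((T ^ j) v).1 m = 0 := hT.pow hv j m (by omega)
    simp [this]
  have h1 : (proSeries c T hT v).1 m = ∑ j ∈ Finset.range J, c j • ((T ^ j) v).1 m := by
    rw [proSeries_apply, finsum_eq_sum_of_support_subset _ hs]
  have h2 : (∑ j ∈ Finset.range J, c j • (T ^ j) v).1 m =
      ∑ j ∈ Finset.range J, c j • ((T ^ j) v).1 m := by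
    simp
  change (proSeries c T hT v).1 m - (∑ j ∈ Finset.range J, c j • (T ^ j) v).1 m = 0
  rw [h1, h2, sub_self]

/-- An operator which differs from the identity by an operator raising the order is bijective. -/
theorem bijective_of_raises {φ : Module.End ℂ (PosCompletion W)} (hφ : Raises (φ - 1)) :
    Function.Bijective φ := by
  constructor
  · rw [← LinearMap.ker_eq_bot, LinearMap.ker_eq_bot']
    intro v hv
    have key : ∀ k, OrdGE k v → OrdGE (k + 1) v := by
      intro k hk m hm
      have h1 := hφ k v hk m hm
      have h2 : (φ - 1) v = -v := by simp [hv]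
      rw [h2] at h1
      exact neg_eq_zero.mp h1
    obtain ⟨N, hN⟩ := v.2
    have all : ∀ j : ℕ, OrdGE (N + j) v := by
      intro j
      induction j with
      | zero => simpa [OrdGE] using hN
      | succ j ih =>
        have := key _ ih
        push_cast
        rwa [← add_assoc]
    apply Subtype.ext
    funext m
    exact all ((m - N).toNat + 1) m (by omega)
  · intro w
    refine ⟨proSeries (fun j => (-1) ^ j) (φ - 1) hφ w, ?_⟩
    set v := proSeries (fun j => (-1) ^ j) (φ - 1) hφ w with hv
    obtain ⟨N, hN⟩ := w.2
    apply Subtype.ext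
    funext m
    set J : ℕ := (m - N).toNat + 1 with hJ
    set s := ∑ j ∈ Finset.range J, ((-1 : ℂ) ^ j) • ((φ - 1) ^ j) w with hs
    have h1 : OrdGE (N + J) (v - s) := proSeries_ordGE_sub _ _ hφ hN J
    have h2 : φ s = w - ((-1 : ℂ) ^ J) • ((φ - 1) ^ J) w := by
      have geom : ∀ n : ℕ, φ (∑ j ∈ Finset.range n, ((-1 : ℂ) ^ j) • ((φ - 1) ^ j) w) =
          w - ((-1 : ℂ) ^ n) • ((φ - 1) ^ n) w := by
        intro n
        induction n with
        | zero => simp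
        | succ n ih =>
          rw [Finset.sum_range_succ, map_add, ih, map_smul]
          have e : φ (((φ - 1) ^ n) w) = ((φ - 1) ^ (n + 1)) w + ((φ - 1) ^ n) w := by
            rw [pow_succ', Module.End.mul_apply]
            simp
          rw [e, pow_succ (-1 : ℂ)]
          module
      exact geom J
    have h3 : OrdGE (N + J) (φ (v - s)) := by
      have h4 := (hφ _ _ h1).mono (k' := N + J) (by omega)
      intro m' hm'
      have e : φ (v - s) = (φ - 1) (v - s) + (v - s) := by simp
      rw [e]
      change ((φ - 1) (v - s)).1 m' + (v - s).1 m' = 0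
      rw [h4 m' hm', h1 m' hm', add_zero]
    have hm : m < N + J := by omega
    have h5 : φ v = φ (v - s) + (w - ((-1 : ℂ) ^ J) • ((φ - 1) ^ J) w) := by
      rw [← h2, ← map_add, sub_add_cancel]
    rw [h5]
    change (φ (v - s)).1 m + (w.1 m - ((-1 : ℂ) ^ J) • (((φ - 1) ^ J) w).1 m) = w.1 m
    rw [h3 m hm, hφ.pow hN J m hm, smul_zero, sub_zero, zero_add]

theorem proSeries_sub_one_raises (c : ℕ → ℂ) (hc : c 0 = 1) (T : Module.End ℂ (PosCompletion W))
    (hT : Raises T) : Raises (proSeries c T hT - 1) := by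
  intro k v hv
  have := proSeries_ordGE_sub c T hT hv 1
  simpa [hc] using this

/-- The exponential `∑_j T^j / j!` of an operator that raises the order, as an element of `GL`. -/
noncomputable def proExp (T : Module.End ℂ (PosCompletion W)) (hT : Raises T) :
    PosCompletion W ≃ₗ[ℂ] PosCompletion W :=
  LinearEquiv.ofBijective (proSeries (fun j => ((j.factorial : ℂ))⁻¹) T hT)
    (bijective_of_raises (proSeries_sub_one_raises _ (by simp) T hT))

end Completion

/-! ### The completed representation and the groups `U_{V,n}` -/

namespace StdGrading

variable {R : Realization A h} {V : Type*} [AddCommGroup V] [Module ℂ V]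
  [LieRingModule (KMAlg R) V] [LieModule ℂ (KMAlg R) V]
  {P : AddSubgroup (Module.Dual ℂ h)} (G : StdGrading R V P)

/-- `g_m`, the sum of the root spaces `g_α` with `α ∈ Δ ∪ {0}` of degree `m`. -/
noncomputable def gPiece (m : ℤ) : Submodule ℂ (KMAlg R) :=
  ⨆ α ∈ degSet G.f (roots R ∪ {0}) m, wtSpace R (KMAlg R) α

/-- `V_m`, the sum of the weight spaces `V_μ` with `μ` of degree `m`. -/
noncomputable def vPiece (m : ℤ) : Submodule ℂ V :=
  ⨆ μ ∈ degSet G.f (wts R V) m, wtSpace R V μ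

theorem lie_mem_wtSpace {α μ : Module.Dual ℂ h} {x : KMAlg R} {v : V}
    (hx : x ∈ wtSpace R (KMAlg R) α) (hv : v ∈ wtSpace R V μ) :
    ⁅x, v⁆ ∈ wtSpace R V (α + μ) := by
  intro t
  rw [leibniz_lie, hx t, hv t, smul_lie, lie_smul, LinearMap.add_apply, add_smul]

theorem lie_mem_vPiece {k j : ℤ} {x : KMAlg R} {v : V} (hx : x ∈ G.gPiece k)
    (hv : v ∈ G.vPiece j) : ⁅x, v⁆ ∈ G.vPiece (k + j) := by
  let B : KMAlg R →ₗ[ℂ] V →ₗ[ℂ] V := (LieModule.toEnd ℂ (KMAlg R) V : KMAlg R →ₗ[ℂ] _)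
  suffices hB : Submodule.map₂ B (G.gPiece k) (G.vPiece j) ≤ G.vPiece (k + j) from
    hB (Submodule.apply_mem_map₂ B hx hv)
  simp only [gPiece, vPiece, Submodule.map₂_iSup_left, Submodule.map₂_iSup_right, iSup_le_iff]
  intro μ hμ α hα
  rw [Submodule.map₂_le]
  intro y hy w hw
  have hyw : ⁅y, w⁆ ∈ wtSpace R V (α + μ) := lie_mem_wtSpace hy hw
  change ⁅y, w⁆ ∈ _
  by_cases h0 : ⁅y, w⁆ = 0
  · rw [h0]
    exact Submodule.zero_mem _
  · obtain ⟨-, hαP, hfα⟩ := hα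
    obtain ⟨-, hμP, hfμ⟩ := hμ
    have hmem : α + μ ∈ degSet G.f (wts R V) (k + j) := by
      refine ⟨fun hbot => h0 ?_, P.add_mem hαP hμP, ?_⟩
      · rw [hbot] at hyw
        exact (Submodule.mem_bot ℂ).mp hyw
      · rw [← hfα, ← hfμ, ← map_add]
        rfl
    exact Submodule.mem_iSup_of_mem (α + μ) (Submodule.mem_iSup_of_mem hmem hyw)

/-- The completion of `g`. -/
noncomputable abbrev gHat := PosCompletion G.gPiece

/-- The completion of `V`. -/
noncomputable abbrev vHat := PosCompletion G.vPiece

/-- The subspace `∏_{k ≥ n} g_k` of the completion of `g`, with the subspace topology, that is,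
the product topology. -/
noncomputable def nHat (n : ℤ) : Submodule ℂ G.gHat where
  carrier := {x | ∀ k < n, x.1 k = 0}
  add_mem' := by
    intro a b ha hb k hk
    change a.1 k + b.1 k = 0
    rw [ha k hk, hb k hk, add_zero]
  zero_mem' := fun _ _ => rfl
  smul_mem' := by
    intro c a ha k hk
    change c • a.1 k = 0
    rw [ha k hk, smul_zero]

theorem nHat_le {n m : ℤ} (hnm : n ≤ m) : G.nHat m ≤ G.nHat n :=
  fun _ hx k hk => hx k (lt_of_lt_of_le hk hnm)

theorem rho_finite (x : G.gHat) (v : G.vHat) (m : ℤ) :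
    (Function.support fun k : ℤ => ⁅(x.1 k : KMAlg R), (v.1 (m - k) : V)⁆).Finite := by
  obtain ⟨N, hN⟩ := x.2
  obtain ⟨K, hK⟩ := v.2
  refine (Set.finite_Icc N (m - K)).subset fun k hk => ?_
  by_contra hlt
  refine hk ?_
  rcases lt_or_ge k N with h1 | h1
  · simp [hN k h1]
  · have h2 : m - k < K := by
      by_contra h3
      exact hlt ⟨h1, by omega⟩
    simp [hK _ h2]

/-- The representation `ρ` extended to the completions: `(ρ(x) v)_m = ∑_k x_k · v_{m-k}`, a finite
sum. -/
noncomputable def rhoHat (x : G.gHat) : Module.End ℂ G.vHat where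
  toFun v := ⟨fun m => ⟨∑ᶠ k : ℤ, ⁅(x.1 k : KMAlg R), (v.1 (m - k) : V)⁆, by
      rw [finsum_eq_sum _ (G.rho_finite x v m)]
      refine Submodule.sum_mem _ fun k _ => ?_
      have := G.lie_mem_vPiece (x.1 k).2 (v.1 (m - k)).2
      rwa [add_sub_cancel] at this⟩, by
    obtain ⟨N, hN⟩ := x.2
    obtain ⟨K, hK⟩ := v.2
    refine ⟨N + K, fun m hm => Subtype.ext (finsum_eq_zero_of_forall_eq_zero fun k => ?_)⟩
    rcases lt_or_ge k N with h1 | h1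
    · simp [hN k h1]
    · simp [hK (m - k) (by omega)]⟩
  map_add' u v := by
    apply Subtype.ext
    funext m
    apply Subtype.ext
    change (∑ᶠ k : ℤ, ⁅(x.1 k : KMAlg R), ((u + v).1 (m - k) : V)⁆) =
      (∑ᶠ k : ℤ, ⁅(x.1 k : KMAlg R), (u.1 (m - k) : V)⁆) +
        ∑ᶠ k : ℤ, ⁅(x.1 k : KMAlg R), (v.1 (m - k) : V)⁆
    rw [← finsum_add_distrib (G.rho_finite x u m) (G.rho_finite x v m)]
    refine finsum_congr fun k => ?_
    rw [← lie_add]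
    rfl
  map_smul' a v := by
    apply Subtype.ext
    funext m
    apply Subtype.ext
    change (∑ᶠ k : ℤ, ⁅(x.1 k : KMAlg R), ((a • v).1 (m - k) : V)⁆) =
      a • ∑ᶠ k : ℤ, ⁅(x.1 k : KMAlg R), (v.1 (m - k) : V)⁆
    rw [smul_finsum]
    refine finsum_congr fun k => ?_
    rw [← lie_smul]
    rfl

theorem rhoHat_raises (x : G.nHat 1) : Raises (G.rhoHat x.1) := by
  intro K v hv m hm
  apply Subtype.ext
  change (∑ᶠ k : ℤ, ⁅(x.1.1 k : KMAlg R), (v.1 (m - k) : V)⁆) = 0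
  refine finsum_eq_zero_of_forall_eq_zero fun k => ?_
  rcases lt_or_ge k 1 with h1 | h1
  · simp [x.2 k h1]
  · simp [hv (m - k) (by omega)]

/-- `exp(ρ(x))` in `GL` of the completion of `V`, for `x` in `∏_{k ≥ 1} g_k`. -/
noncomputable def expRho (x : G.nHat 1) : G.vHat ≃ₗ[ℂ] G.vHat :=
  proExp (G.rhoHat x.1) (G.rhoHat_raises x)

/-- The homogeneous component `x_k` of `x`, as an element of `∏_{k ≥ 1} g_k`. -/
noncomputable def component (x : G.nHat 1) (k : ℤ) : G.nHat 1 :=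
  ⟨⟨fun j => if j = k then x.1.1 j else 0, by
    obtain ⟨N, hN⟩ := x.1.2
    refine ⟨N, fun m hm => ?_⟩
    simp [hN m hm]⟩, by
    intro j hj
    have := x.2 j hj
    simp [this]⟩

/-- The finite product `exp(ρ(x_{n+j-1})) ⋯ exp(ρ(x_{n+1})) exp(ρ(x_n))` of `j` factors. -/
noncomputable def partialProd (n : ℕ) (x : G.nHat 1) : ℕ → (G.vHat ≃ₗ[ℂ] G.vHat)
  | 0 => 1
  | j + 1 => G.expRho (G.component x ((n : ℤ) + j)) * partialProd n x j

/-- `g` is the infinite product `∏_{k=n}^∞ exp(ρ(x_k))`, read from right to left, that is, the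
limit of the finite products in `GL` of the completion of `V`. -/
def IsInfProd (n : ℕ) (x : G.nHat 1) (g : G.vHat ≃ₗ[ℂ] G.vHat) : Prop :=
  Tendsto (G.partialProd n x) atTop (𝓝 g)

/-- For `n ≥ 1`, the inclusion of `∏_{k ≥ n} g_k` into `∏_{k ≥ 1} g_k`. -/
noncomputable def incl {n : ℕ} (hn : 1 ≤ n) (x : G.nHat n) : G.nHat 1 :=
  ⟨x.1, G.nHat_le (by exact_mod_cast hn) x.2⟩

/-- The group `U_{V,n}` of all products `∏_{k=n}^∞ exp(ρ(x_k))` with `x_k ∈ g_k`, as a subspace of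
`GL` of the completion of `V`. -/
def UHat {n : ℕ} (hn : 1 ≤ n) : Set (G.vHat ≃ₗ[ℂ] G.vHat) :=
  {g | ∃ x : G.nHat n, G.IsInfProd n (G.incl hn x) g}

end StdGrading

end KacMoody

/-! Filter the operators on the completion of `V` by how far they raise the order. Elements of the
completed algebra `N = ∏_{k ≥ n} g_k` act by operators in the first step, and if `x - y` lies in
step `k`, then `exp x - exp y` agrees with `x - y` modulo step `k + 1` (`IsExp.sub_sub_mem`). Both
maps of the theorem are therefore triangular: modulo step `k + 1`, replacing `x` by its truncation
below degree `k` changes the value by exactly `ρ(x_k)`.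

That the two maps have the same image rests on the closure of `exp N` under products. In place of
the Baker–Campbell–Hausdorff formula, the proof uses the derivation `D = [d, ·]` for the degree
operator `d`; on the quotient of step `k` by step `k + 1`, `D` is multiplication by `k`. The
logarithmic derivative `D(g) g⁻¹` of an exponential `g` from `N` lies in `N` (`IsExp.exists_der`).
Conversely, a unipotent `g` with `D g = y g` and `y ∈ N` is an exponential: its logarithm is built
degree by degree, dividing by the degree (`IsProLie.exists_isExp_of_der`). If `D g = r g` and `D h =
s h`, then `D(gh) = (r + g s g⁻¹) gh`, and conjugation by `g` preserves `N`, so `gh` is an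
exponential (`IsExp.exists_mul`). Splitting off the factor of lowest degree repeatedly turns an
exponential into an infinite product; conversely, limits of partial products are exponentials by
completeness of `N`.

Faithfulness allows `x_k` to be read off from its action on `V`, which gives completeness of the
image of `N` and injectivity of both maps. Forward continuity holds because each output degree is a
finite sum of multilinear expressions in finitely many components. For the inverse, triangularity
expresses the action of `x_k` through the value of the map and the components below `k`. As `g_k` is
finite dimensional (`wtSpace_finite`, through the triangular decomposition), induction on `k` makes
every `x_k` continuous (`exists_homeomorph_of_triangular`). -/

/-! ### Exponentials in filtered algebras -/

namespace FilteredExp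

open Finset

variable {E : Type*} [Ring E] [Algebra ℂ E]

/-- A separated multiplicative decreasing filtration by subspaces. -/
structure IsFiltration (F : ℕ → Submodule ℂ E) : Prop where
  one_mem : (1 : E) ∈ F 0
  mul_mem : ∀ {i j a b}, a ∈ F i → b ∈ F j → a * b ∈ F (i + j)
  anti : Antitone F
  sep : ∀ a, (∀ j, a ∈ F j) → a = 0

/-- `s` is the sum of the series `∑ a_j`, with terms `a_j ∈ F j`. -/
structure ProSum (F : ℕ → Submodule ℂ E) (a : ℕ → E) (s : E) : Prop where
  term_mem : ∀ j, a j ∈ F j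
  sub_mem : ∀ j, s - ∑ i ∈ range j, a i ∈ F j

/-- `g = exp x`. -/
def IsExp (F : ℕ → Submodule ℂ E) (x g : E) : Prop :=
  ProSum F (fun j => ((j.factorial : ℂ))⁻¹ • x ^ j) g

variable {F : ℕ → Submodule ℂ E} (hF : IsFiltration F)

include hF

theorem IsFiltration.pow_mem {x : E} (hx : x ∈ F 1) (j : ℕ) : x ^ j ∈ F j := by
  induction j with
  | zero => simpa using hF.one_mem
  | succ j ih => rw [pow_succ]; exact hF.mul_mem ih hx

theorem IsFiltration.eq_of_sub_mem {a b : E} (hab : ∀ j, a - b ∈ F j) : a = b :=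
  sub_eq_zero.mp (hF.sep _ hab)

omit hF in
theorem ProSum.mem {a : ℕ → E} {s : E} (h : ProSum F a s) {k : ℕ} (ha : ∀ j, a j ∈ F k) :
    s ∈ F k := by
  have := (F k).add_mem (h.sub_mem k) ((F k).sum_mem fun i (_ : i ∈ range k) => ha i)
  rwa [sub_add_cancel] at this

theorem ProSum.mem_zero {a : ℕ → E} {s : E} (h : ProSum F a s) : s ∈ F 0 :=
  h.mem fun j => hF.anti (Nat.zero_le j) (h.term_mem j)

theorem ProSum.unique {a : ℕ → E} {s t : E} (hs : ProSum F a s) (ht : ProSum F a t) : s = t := by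
  refine hF.eq_of_sub_mem fun j => ?_
  have := (F j).sub_mem (hs.sub_mem j) (ht.sub_mem j)
  rwa [sub_sub_sub_cancel_right] at this

theorem ProSum.mul {a b : ℕ → E} {s t : E} (hs : ProSum F a s) (ht : ProSum F b t) :
    ProSum F (fun j => ∑ k ∈ range (j + 1), a k * b (j - k)) (s * t) := by
  refine ⟨fun j => (F j).sum_mem fun k hk => ?_, fun j => ?_⟩
  · have := hF.mul_mem (hs.term_mem k) (ht.term_mem (j - k))
    rwa [Nat.add_sub_cancel' (by simpa [Nat.lt_succ_iff] using hk)] at this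
  · rw [sum_range_diag_flip j fun k i => a k * b i]
    have e : s * t - ∑ k ∈ range j, ∑ i ∈ range (j - k), a k * b i =
        (s - ∑ k ∈ range j, a k) * t + ∑ k ∈ range j, a k * (t - ∑ i ∈ range (j - k), b i) := by
      simp only [mul_sub, sub_mul, sum_sub_distrib, sum_mul, mul_sum]
      abel
    rw [e]
    refine (F j).add_mem ?_ ((F j).sum_mem fun k hk => ?_)
    · simpa using hF.mul_mem (hs.sub_mem j) (ht.mem_zero hF)
    · have := hF.mul_mem (hs.term_mem k) (ht.sub_mem (j - k))
      rwa [Nat.add_sub_cancel' (by simpa using (mem_range.mp hk).le)] at this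

omit hF in
theorem IsExp.mem_one {x g : E} (h : IsExp F x g) : x ∈ F 1 := by
  simpa using h.term_mem 1

theorem IsExp.mem_zero {x g : E} (h : IsExp F x g) : g ∈ F 0 :=
  ProSum.mem_zero hF h

omit hF in
theorem IsExp.sub_one_mem {x g : E} (h : IsExp F x g) : g - 1 ∈ F 1 := by
  simpa using h.sub_mem 1

theorem isExp_zero : IsExp F (0 : E) 1 := by
  refine ⟨fun j => (F j).smul_mem _ (hF.pow_mem (F 1).zero_mem j), fun j => ?_⟩
  cases j with
  | zero => simpa using hF.one_mem
  | succ j => simp [sum_range_succ']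

/-- Since `x` and `y` lie in `F 1`, telescoping puts `x ^ j - y ^ j` one step deeper for each extra
power, so only the linear terms survive modulo `F (k + 1)`. This is the source of every
triangularity statement below. -/
theorem IsExp.sub_sub_mem {x y g h : E} (hg : IsExp F x g) (hh : IsExp F y h) {k : ℕ}
    (hxy : x - y ∈ F k) : (g - h) - (x - y) ∈ F (k + 1) := by
  have hx := hg.mem_one
  have hy := hh.mem_one
  have hpow : ∀ j, x ^ (j + 1) - y ^ (j + 1) ∈ F (k + j) := by
    intro j
    induction j with
    | zero => simpa using hxy
    | succ j ih =>
      have e : x ^ (j + 2) - y ^ (j + 2) =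
          x ^ (j + 1) * (x - y) + (x ^ (j + 1) - y ^ (j + 1)) * y := by
        rw [pow_succ x (j + 1), pow_succ y (j + 1)]
        noncomm_ring
      rw [e]
      refine add_mem ?_ ?_
      · have := hF.mul_mem (hF.pow_mem hx (j + 1)) hxy
        rwa [add_comm] at this
      · have := hF.mul_mem ih hy
        rwa [add_assoc] at this
  -- With `k + 2` terms the remainder lies in `F (k + 2)`. The constant terms cancel, the linear
  -- ones give `x - y`, and the other `k` terms are handled by `h2`.
  have h1 := sub_mem (hg.sub_mem (k + 2)) (hh.sub_mem (k + 2))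
  have h2 : ∀ j ∈ range k, ((j + 2).factorial : ℂ)⁻¹ • (x ^ (j + 2) - y ^ (j + 2)) ∈ F (k + 1) :=
    fun j _ => Submodule.smul_mem _ _ (hF.anti (by omega) (hpow (j + 1)))
  have h3 := add_mem (hF.anti (by omega : k + 1 ≤ k + 2) h1) (sum_mem h2)
  convert h3 using 1
  simp only [sum_range_succ', smul_sub, sum_sub_distrib]
  simp
  abel

/-- The exponential is the identity to leading order, so `x - y` can be pushed one step deeper at a
time until depth `k` is reached. -/
theorem IsExp.sub_mem_of_sub_mem {x y g h : E} (hg : IsExp F x g) (hh : IsExp F y h) {k : ℕ}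
    (hgh : g - h ∈ F k) : x - y ∈ F k := by
  have key : ∀ j, j ≤ k → x - y ∈ F j := by
    intro j
    induction j with
    | zero => exact fun _ => hF.anti zero_le_one (sub_mem (hg.mem_one) (hh.mem_one))
    | succ j ih =>
      intro hj
      have h1 := hg.sub_sub_mem hF hh (ih (by omega))
      have := sub_mem (hF.anti hj hgh) h1
      rwa [sub_sub_cancel] at this
  exact key k le_rfl

theorem IsExp.sub_mem' {x y g h : E} (hg : IsExp F x g) (hh : IsExp F y h) {k : ℕ}
    (hxy : x - y ∈ F k) : g - h ∈ F k := by
  have := add_mem (hF.anti (Nat.le_succ k) (hg.sub_sub_mem hF hh hxy)) hxy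
  rwa [sub_add_cancel] at this

theorem IsExp.neg_mul {x g h : E} (hg : IsExp F x g) (hh : IsExp F (-x) h) : h * g = 1 := by
  refine ProSum.unique hF (ProSum.mul hF hh hg) ?_
  have e : (fun j : ℕ => ∑ k ∈ range (j + 1), ((k.factorial : ℂ)⁻¹ • (-x) ^ k) *
      (((j - k).factorial : ℂ)⁻¹ • x ^ (j - k))) = fun j => (j.factorial : ℂ)⁻¹ • (0 : E) ^ j := by
    funext j
    rw [← neg_add_cancel x, (Commute.neg_left (Commute.refl x)).add_pow, smul_sum]
    refine sum_congr rfl fun k hk => ?_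
    have hk' : k ≤ j := by simpa [Nat.lt_succ_iff] using hk
    rw [smul_mul_smul_comm, ← nsmul_eq_mul', ← Nat.cast_smul_eq_nsmul ℂ, smul_smul,
      Nat.cast_choose ℂ hk']
    congr 1
    have := Nat.cast_ne_zero (R := ℂ).mpr (Nat.factorial_ne_zero j)
    field_simp
  rw [e]
  exact isExp_zero hF

/-- The derivation `T ↦ [d, T]`. -/
def der (d T : E) : E := d * T - T * d

/-- The operator `z ↦ x z - z x`. -/
def adj (x : E) : E →ₗ[ℂ] E := LinearMap.mulLeft ℂ x - LinearMap.mulRight ℂ x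

omit hF in
theorem adj_apply (x z : E) : adj x z = x * z - z * x := rfl

-- Left multiplication by `x` is the sum of the commuting operators `adj x` and right multiplication
-- by `x`; the binomial theorem does the rest.
omit hF in
theorem pow_mul_eq_sum (x z : E) (j : ℕ) :
    x ^ j * z = ∑ k ∈ range (j + 1),
      j.choose k • (((adj x) ^ k) z * x ^ (j - k)) := by
  have h1 : LinearMap.mulLeft ℂ x = adj x + LinearMap.mulRight ℂ x := by
    ext z
    simp [adj_apply]
  have hc : Commute (adj x) (LinearMap.mulRight ℂ x) := by
    ext z
    simp [adj_apply, sub_mul, mul_assoc]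
  have h2 : (LinearMap.mulLeft ℂ x) ^ j = ∑ k ∈ range (j + 1),
      (LinearMap.mulRight ℂ x) ^ (j - k) * (adj x) ^ k * (j.choose k : Module.End ℂ E) := by
    rw [h1, hc.add_pow]
    exact sum_congr rfl fun k _ => by rw [(hc.pow_pow k (j - k)).eq]
  have h3 := congrArg (fun T : Module.End ℂ E => T z) h2
  simp only [LinearMap.pow_mulLeft, LinearMap.pow_mulRight, LinearMap.mulLeft_apply] at h3
  rw [h3, LinearMap.sum_apply]
  refine sum_congr rfl fun k _ => ?_
  rw [← nsmul_eq_mul']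
  simp

/-- The coefficients of `[d, exp x] exp(-x)`, up to factorials. -/
def derCoeff (d x : E) : ℕ → E
  | 0 => 0
  | k + 1 => ((adj x) ^ k) (der d x)

-- The Leibniz rule and `pow_mul_eq_sum` give the recursion, and Pascal's rule merges its two sums.
-- The shift in `derCoeff`, with zeroth term 0, gives the coefficients `1 / (k + 1)!` of the
-- logarithmic derivative of `exp`.
omit hF in
theorem der_pow_eq_sum (d x : E) (j : ℕ) :
    der d (x ^ j) = ∑ k ∈ range (j + 1), j.choose k • (derCoeff d x k * x ^ (j - k)) := by
  induction j with
  | zero => simp [der, derCoeff]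
  | succ j ih =>
    have e : der d (x ^ (j + 1)) = der d (x ^ j) * x + x ^ j * der d x := by
      simp only [der, pow_succ]
      noncomm_ring
    rw [e, ih, pow_mul_eq_sum, sum_mul]
    have e2 : ∑ k ∈ range (j + 1), (j.choose k • (derCoeff d x k * x ^ (j - k))) * x =
        ∑ k ∈ range (j + 1 + 1), j.choose k • (derCoeff d x k * x ^ (j + 1 - k)) := by
      rw [sum_range_succ _ (j + 1), Nat.choose_succ_self, zero_smul, add_zero]
      refine sum_congr rfl fun k hk => ?_
      rw [smul_mul_assoc, mul_assoc, ← pow_succ,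
        Nat.succ_sub (by simpa [Nat.lt_succ_iff] using hk : k ≤ j)]
    rw [e2, sum_range_succ', sum_range_succ' _ (j + 1)]
    simp only [derCoeff, zero_mul, smul_zero, add_zero, ← sum_add_distrib]
    refine sum_congr rfl fun k _ => ?_
    rw [Nat.choose_succ_succ, add_smul, add_comm, Nat.add_sub_add_right]

-- Dividing a binomial sum by `j!` turns it into the `j`-th term of a Cauchy product, which
-- `ProSum.mul` can sum.
omit hF in
theorem cauchy_of_choose {b : ℕ → E} {x y : E} {j : ℕ}
    (h : y = ∑ k ∈ range (j + 1), j.choose k • (b k * x ^ (j - k))) :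
    (j.factorial : ℂ)⁻¹ • y = ∑ k ∈ range (j + 1), ((k.factorial : ℂ)⁻¹ • b k) *
      (((j - k).factorial : ℂ)⁻¹ • x ^ (j - k)) := by
  rw [h, smul_sum]
  refine sum_congr rfl fun k hk => ?_
  have hk' : k ≤ j := by simpa [Nat.lt_succ_iff] using hk
  rw [smul_mul_smul_comm, ← Nat.cast_smul_eq_nsmul ℂ, smul_smul, Nat.cast_choose ℂ hk']
  congr 1
  have := Nat.cast_ne_zero (R := ℂ).mpr (Nat.factorial_ne_zero j)
  field_simp

/-- `N` is a Lie algebra in `F 1`, complete for the filtration and stable under `[d, ·]`. -/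
structure IsProLie (F : ℕ → Submodule ℂ E) (d : E) (N : Submodule ℂ E) : Prop where
  le : N ≤ F 1
  der_mem : ∀ x ∈ N, der d x ∈ N
  lie_mem : ∀ x ∈ N, ∀ y ∈ N, x * y - y * x ∈ N
  complete : ∀ s : ℕ → E, (∀ j, s j ∈ N) → (∀ j, s (j + 1) - s j ∈ F j) →
    ∃ t ∈ N, ∀ j, t - s j ∈ F j

variable {d : E} {N : Submodule ℂ E}

omit hF in
theorem IsProLie.exists_proSum (hN : IsProLie F d N) {a : ℕ → E} (ha : ∀ j, a j ∈ N)
    (haF : ∀ j, a j ∈ F j) : ∃ s ∈ N, ProSum F a s := by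
  obtain ⟨t, ht, h⟩ := hN.complete (fun j => ∑ i ∈ range j, a i) (fun j => sum_mem fun i _ => ha i)
    fun j => by simpa [sum_range_succ] using haF j
  exact ⟨t, ht, haF, h⟩

omit hF in
theorem IsProLie.ad_pow_mem (hN : IsProLie F d N) {x z : E} (hx : x ∈ N) (hz : z ∈ N) (k : ℕ) :
    ((adj x) ^ k) z ∈ N := by
  induction k with
  | zero => simpa
  | succ k ih =>
    rw [pow_succ', Module.End.mul_apply, adj_apply]
    exact hN.lie_mem _ hx _ ih

theorem IsFiltration.ad_pow_mem {x z : E} (hx : x ∈ F 1) (hz : z ∈ F 1) (k : ℕ) :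
    ((adj x) ^ k) z ∈ F (k + 1) := by
  induction k with
  | zero => simpa
  | succ k ih =>
    rw [pow_succ', Module.End.mul_apply, adj_apply]
    refine sub_mem ?_ (hF.mul_mem ih hx)
    rw [add_comm]
    exact hF.mul_mem hx ih

/-- Here `y = exp(ad x) z = g z g⁻¹`, a series of iterated brackets that converges inside `N`. -/
theorem IsExp.conj (hN : IsProLie F d N) {x g z : E} (hx : x ∈ N) (hg : IsExp F x g)
    (hz : z ∈ N) : ∃ y ∈ N, g * z = y * g := by
  obtain ⟨y, hy, hys⟩ := hN.exists_proSum
    (a := fun k => (k.factorial : ℂ)⁻¹ • ((adj x) ^ k) z)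
    (fun k => N.smul_mem _ (hN.ad_pow_mem hx hz k))
    (fun k => Submodule.smul_mem _ _
      (hF.anti (Nat.le_succ k) (hF.ad_pow_mem (hN.le hx) (hN.le hz) k)))
  refine ⟨y, hy, ProSum.unique hF ?_ (ProSum.mul hF hys hg)⟩
  have hz0 : z ∈ F 0 := hF.anti zero_le_one (hN.le hz)
  have : ProSum F (fun j => (j.factorial : ℂ)⁻¹ • (x ^ j * z)) (g * z) := by
    refine ⟨fun j => ?_, fun j => ?_⟩
    · rw [← smul_mul_assoc]
      exact hF.mul_mem (hg.term_mem j) hz0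
    · have := hF.mul_mem (hg.sub_mem j) hz0
      simpa [sub_mul, sum_mul] using this
  convert this using 2 with j
  exact (cauchy_of_choose (pow_mul_eq_sum x z j)).symm

omit hF [Algebra ℂ E] in
theorem der_sub (d a b : E) : der d (a - b) = der d a - der d b := by
  simp only [der]; noncomm_ring

omit hF [Algebra ℂ E] in
theorem der_sum {ι : Type*} (d : E) (s : Finset ι) (a : ι → E) :
    der d (∑ i ∈ s, a i) = ∑ i ∈ s, der d (a i) := by
  simp only [der, mul_sum, sum_mul, sum_sub_distrib]

omit hF in
theorem der_smul (d : E) (c : ℂ) (a : E) : der d (c • a) = c • der d a := by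
  simp only [der, smul_sub, mul_smul_comm, smul_mul_assoc]

omit hF [Algebra ℂ E] in
theorem der_mul (d a b : E) : der d (a * b) = der d a * b + a * der d b := by
  simp only [der]; noncomm_ring

theorem der_mem_of_mem (hd : d ∈ F 0) {k : ℕ} {a : E} (ha : a ∈ F k) : der d a ∈ F k := by
  refine sub_mem ?_ (hF.mul_mem ha hd)
  simpa using hF.mul_mem hd ha

/-- The logarithmic derivative is `y = ∑ (ad x)^k (D x) / (k + 1)!`. Each term is in `N` because `N`
is stable under `D` and under brackets. -/
theorem IsExp.exists_der (hN : IsProLie F d N) (hd : d ∈ F 0) {x g : E} (hx : x ∈ N)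
    (hg : IsExp F x g) : ∃ y ∈ N, der d g = y * g := by
  obtain ⟨y, hy, hys⟩ := hN.exists_proSum
    (a := fun k => (k.factorial : ℂ)⁻¹ • derCoeff d x k)
    (fun k => N.smul_mem _ (by
      cases k with
      | zero => exact N.zero_mem
      | succ k => exact hN.ad_pow_mem hx (hN.der_mem x hx) k))
    (fun k => Submodule.smul_mem _ _ (by
      cases k with
      | zero => exact Submodule.zero_mem _
      | succ k => exact hF.ad_pow_mem (hN.le hx) (der_mem_of_mem hF hd (hN.le hx)) k))
  refine ⟨y, hy, ProSum.unique hF ?_ (ProSum.mul hF hys hg)⟩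
  have : ProSum F (fun j => (j.factorial : ℂ)⁻¹ • der d (x ^ j)) (der d g) := by
    refine ⟨fun j => Submodule.smul_mem _ _ (der_mem_of_mem hF hd (hF.pow_mem (hN.le hx) j)), fun j => ?_⟩
    have := der_mem_of_mem hF hd (hg.sub_mem j)
    simpa [der_sub, der_sum, der_smul] using this
  convert this using 2 with j
  exact (cauchy_of_choose (der_pow_eq_sum d x j)).symm

/-- The limit of a Cauchy sequence of exponentials of elements of `N` is such an exponential. -/
theorem IsProLie.exists_isExp_limit (hN : IsProLie F d N) (hex : ∀ x ∈ N, ∃ g, IsExp F x g)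
    {x g : ℕ → E} (hx : ∀ j, x j ∈ N) (hg : ∀ j, IsExp F (x j) (g j))
    (hc : ∀ j, g (j + 1) - g j ∈ F j) : ∃ z ∈ N, ∃ a, IsExp F z a ∧ ∀ j, a - g j ∈ F j := by
  obtain ⟨z, hz, hzx⟩ := hN.complete x hx fun j => (hg (j + 1)).sub_mem_of_sub_mem hF (hg j) (hc j)
  obtain ⟨a, ha⟩ := hex z hz
  exact ⟨z, hz, a, ha, fun j => ha.sub_mem' hF (hg j) (hzx j)⟩

/-- Successive approximation. If `e = exp x` agrees with `g` up to `F (k + 1)` and `D e = r e`, then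
`D (g - e)` is congruent both to `y - r` and to `(k + 1)(g - e)` modulo `F (k + 2)`. The correction
`(y - r) / (k + 1)` is in `N`, although `g - e` itself need not be. -/
theorem IsProLie.exists_isExp_of_der (hN : IsProLie F d N) (hd : d ∈ F 0)
    (hdF : ∀ (k : ℕ), ∀ a ∈ F k, der d a - (k : ℂ) • a ∈ F (k + 1))
    (hex : ∀ x ∈ N, ∃ g, IsExp F x g) {g y : E} (hg : g - 1 ∈ F 1) (hy : y ∈ N)
    (hgy : der d g = y * g) : ∃ z ∈ N, IsExp F z g := by
  have step : ∀ (k : ℕ) (x e : E), x ∈ N → IsExp F x e → g - e ∈ F (k + 1) →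
      ∃ x' ∈ N, ∃ e', IsExp F x' e' ∧ g - e' ∈ F (k + 2) := by
    intro k x e hx he hge
    obtain ⟨r, hr, hre⟩ := he.exists_der hF hN hd hx
    have h1 : der d (g - e) - (y - r) ∈ F (k + 2) := by
      have e1 : der d (g - e) - (y - r) = (y - r) * (e - 1) + y * (g - e) := by
        rw [der_sub, hgy, hre]; noncomm_ring
      -- A priori `y - r` is only in `F 1`. Inverting `e` in `D (g - e) - y (g - e) = (y - r) e`
      -- gives the required depth.
      have h2 : y - r ∈ F (k + 1) := by
        obtain ⟨e', he'⟩ := hex (-x) (N.neg_mem hx)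
        have h3 : e * e' = 1 := by
          have := he'.neg_mul hF (h := e) (by simpa using he)
          exact this
        have e2 : y - r = (der d (g - e) - y * (g - e)) * e' := by
          rw [der_sub, hgy, hre]
          have : (y * g - r * e - y * (g - e)) * e' = (y - r) * (e * e') := by noncomm_ring
          rw [this, h3, mul_one]
        rw [e2]
        have h4 : y * (g - e) ∈ F (k + 1) := by
          have := hF.mul_mem (hN.le hy) hge
          exact hF.anti (by omega) this
        simpa using hF.mul_mem (sub_mem (der_mem_of_mem hF hd hge) h4) (he'.mem_zero hF)
      rw [e1]
      refine add_mem (by simpa [add_assoc] using hF.mul_mem h2 (he.sub_one_mem)) ?_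
      have := hF.mul_mem (hN.le hy) hge
      rwa [add_comm] at this
    have hk : ((k + 1 : ℕ) : ℂ) ≠ 0 := Nat.cast_ne_zero.mpr (Nat.succ_ne_zero k)
    set u := ((k + 1 : ℕ) : ℂ)⁻¹ • (y - r) with hu
    have hgu : (g - e) - u ∈ F (k + 2) := by
      have h5 := Submodule.smul_mem _ (((k + 1 : ℕ) : ℂ)⁻¹) (sub_mem h1 (hdF (k + 1) _ hge))
      convert h5 using 1
      rw [sub_sub_sub_cancel_left, smul_sub, smul_smul, inv_mul_cancel₀ hk, one_smul]
    have huN : u ∈ N := N.smul_mem _ (N.sub_mem hy hr)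
    have huF : u ∈ F (k + 1) := by
      have := sub_mem hge (hF.anti (by omega : k + 1 ≤ k + 2) hgu)
      rwa [sub_sub_cancel] at this
    obtain ⟨e', he'⟩ := hex (x + u) (N.add_mem hx huN)
    refine ⟨x + u, N.add_mem hx huN, e', he', ?_⟩
    -- Adding `u` to the exponent changes the exponential by `u` modulo `F (k + 2)`, which removes
    -- the leading part of `g - e`.
    have h6 := he'.sub_sub_mem hF he (k := k + 1) (by simpa using huF)
    have := sub_mem hgu h6
    convert this using 1
    abel
  choose! X hX E' hE' hgE using step
  let S : ℕ → E × E := fun j => Nat.rec (0, 1) (fun k p => (X k p.1 p.2, E' k p.1 p.2)) j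
  have hS : ∀ j, (S j).1 ∈ N ∧ IsExp F (S j).1 (S j).2 ∧ g - (S j).2 ∈ F (j + 1) := by
    intro j
    induction j with
    | zero => exact ⟨N.zero_mem, isExp_zero hF, hg⟩
    | succ j ih =>
      obtain ⟨h1, h2, h3⟩ := ih
      exact ⟨hX j _ _ h1 h2 h3, hE' j _ _ h1 h2 h3, hgE j _ _ h1 h2 h3⟩
  obtain ⟨z, hz, a, ha, haS⟩ := hN.exists_isExp_limit hF hex (x := fun j => (S j).1)
    (g := fun j => (S j).2) (fun j => (hS j).1) (fun j => (hS j).2.1) fun j => by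
      have := sub_mem (hF.anti (by omega : j ≤ j + 1) (hS j).2.2)
        (hF.anti (by omega : j ≤ j + 1 + 1) (hS (j + 1)).2.2)
      rwa [sub_sub_sub_cancel_left] at this
  refine ⟨z, hz, ?_⟩
  have : a = g := hF.eq_of_sub_mem fun j => by
    have := sub_mem (haS j) (hF.anti (by omega : j ≤ j + 1) (hS j).2.2)
    convert this using 1
    abel
  rwa [← this]

/-- The exponentials of elements of `N` are closed under multiplication. -/
theorem IsExp.exists_mul (hN : IsProLie F d N) (hd : d ∈ F 0)
    (hdF : ∀ (k : ℕ), ∀ a ∈ F k, der d a - (k : ℂ) • a ∈ F (k + 1))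
    (hex : ∀ x ∈ N, ∃ g, IsExp F x g) {x y g h : E} (hx : x ∈ N) (hy : y ∈ N)
    (hg : IsExp F x g) (hh : IsExp F y h) : ∃ z ∈ N, IsExp F z (g * h) := by
  obtain ⟨r, hr, hrg⟩ := hg.exists_der hF hN hd hx
  obtain ⟨s, hs, hsh⟩ := hh.exists_der hF hN hd hy
  obtain ⟨t, ht, htg⟩ := hg.conj hF hN hx hs
  refine hN.exists_isExp_of_der hF hd hdF hex (y := r + t) ?_ (N.add_mem hr ht) ?_
  · have : g * h - 1 = (g - 1) * h + (h - 1) := by noncomm_ring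
    rw [this]
    exact add_mem (hF.mul_mem (hg.sub_one_mem) (hh.mem_zero hF)) (hh.sub_one_mem)
  · rw [der_mul, hrg, hsh, ← mul_assoc, htg]
    noncomm_ring

end FilteredExp

/-! ### Finite dimensionality of the root spaces -/

namespace KacMoody

section Nested

variable {L : Type*} [LieRing L] [LieAlgebra ℂ L] {ι : Type*}

/-- The right nested bracket `[u j₁, [u j₂, …, [u jₖ, u i]]]`. -/
def nest (u : ι → L) (i : ι) : List ι → L
  | [] => u i
  | j :: w => ⁅u j, nest u i w⁆

/-- The span of the right nested brackets. -/
def nestSpan (u : ι → L) : Submodule ℂ L :=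
  Submodule.span ℂ (Set.range fun p : ι × List ι => nest u p.1 p.2)

theorem nest_mem (u : ι → L) (i : ι) (w : List ι) : nest u i w ∈ nestSpan u :=
  Submodule.subset_span ⟨(i, w), rfl⟩

theorem lie_mem_of_nest {u : ι → L} {S : Submodule ℂ L} {y : L}
    (hy : ∀ i w, ⁅y, nest u i w⁆ ∈ S) {x : L} (hx : x ∈ nestSpan u) : ⁅y, x⁆ ∈ S := by
  induction hx using Submodule.span_induction with
  | mem x hx => obtain ⟨p, rfl⟩ := hx; exact hy _ _
  | zero => simp
  | add a b _ _ ha hb => rw [lie_add]; exact S.add_mem ha hb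
  | smul c a _ ha => rw [lie_smul]; exact S.smul_mem c ha

theorem lie_gen_mem_nestSpan (u : ι → L) (j : ι) {x : L} (hx : x ∈ nestSpan u) :
    ⁅u j, x⁆ ∈ nestSpan u :=
  lie_mem_of_nest (fun i w => nest_mem u i (j :: w)) hx

theorem lie_nest_mem_span {u : ι → L} {y : L} (hy : ∀ i, ∃ c : ℂ, ⁅y, u i⁆ = c • u i) (i : ι)
    (w : List ι) : ∃ c : ℂ, ⁅y, nest u i w⁆ = c • nest u i w := by
  induction w with
  | nil => exact hy i
  | cons j w ih =>
    obtain ⟨c, hc⟩ := ih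
    obtain ⟨b, hb⟩ := hy j
    refine ⟨b + c, ?_⟩
    rw [nest, leibniz_lie, hb, hc, smul_lie, lie_smul, add_smul]

theorem lie_cartan_mem_nestSpan {u : ι → L} {y : L} (hy : ∀ i, ∃ c : ℂ, ⁅y, u i⁆ = c • u i)
    {x : L} (hx : x ∈ nestSpan u) : ⁅y, x⁆ ∈ nestSpan u := by
  refine lie_mem_of_nest (fun i w => ?_) hx
  obtain ⟨c, hc⟩ := lie_nest_mem_span hy i w
  rw [hc]
  exact Submodule.smul_mem _ _ (nest_mem u i w)

/-- By the Jacobi identity, bracketing with an opposite generator either replaces one letter by an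
element of `H`, which acts by a scalar on the rest of the word, or passes on to a shorter word. -/
theorem lie_opp_mem {u v : ι → L} {H : Submodule ℂ L}
    (hH : ∀ y ∈ H, ∀ i, ∃ c : ℂ, ⁅y, u i⁆ = c • u i) (hvu : ∀ i j, ⁅v i, u j⁆ ∈ H) (j : ι)
    {x : L} (hx : x ∈ nestSpan u) : ⁅v j, x⁆ ∈ nestSpan u ⊔ H := by
  refine lie_mem_of_nest (fun i w => ?_) hx
  induction w with
  | nil => exact Submodule.mem_sup_right (hvu _ _)
  | cons k w ih =>
    rw [nest, leibniz_lie]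
    refine Submodule.mem_sup_left (Submodule.add_mem _ ?_ ?_)
    · exact lie_cartan_mem_nestSpan (hH _ (hvu _ _)) (nest_mem u i w)
    · obtain ⟨a, ha, b, hb, hab⟩ := Submodule.mem_sup.mp ih
      rw [← hab, lie_add]
      refine Submodule.add_mem _ (lie_gen_mem_nestSpan u k ha) ?_
      obtain ⟨c, hc⟩ := hH b hb k
      rw [← lie_skew, hc]
      exact Submodule.neg_mem _ (Submodule.smul_mem _ _ (nest_mem u k []))

/-- The triangular decomposition: the nested brackets of the `u i`, those of the `v i`, and `H` span
the Lie algebra that they generate. -/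
theorem triangular_eq_top {u v : ι → L} {H : Submodule ℂ L}
    (hHu : ∀ y ∈ H, ∀ i, ∃ c : ℂ, ⁅y, u i⁆ = c • u i)
    (hHv : ∀ y ∈ H, ∀ i, ∃ c : ℂ, ⁅y, v i⁆ = c • v i)
    (hHH : ∀ y ∈ H, ∀ z ∈ H, ⁅y, z⁆ = 0) (hvu : ∀ i j, ⁅v i, u j⁆ ∈ H)
    (hgen : ∀ K : LieSubalgebra ℂ L, (∀ i, u i ∈ K) → (∀ i, v i ∈ K) → (∀ y ∈ H, y ∈ K) → K = ⊤) :
    nestSpan u ⊔ H ⊔ nestSpan v = ⊤ := by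
  set S := nestSpan u ⊔ H ⊔ nestSpan v with hS
  have huS : nestSpan u ≤ S := le_sup_left.trans le_sup_left
  have hHS : H ≤ S := le_sup_right.trans le_sup_left
  have hvS : nestSpan v ≤ S := le_sup_right
  have huHS : nestSpan u ⊔ H ≤ S := le_sup_left
  have hvHS : nestSpan v ⊔ H ≤ S := sup_le hvS hHS
  have huv : ∀ i j, ⁅u i, v j⁆ ∈ H := fun i j => by
    rw [← lie_skew]; exact H.neg_mem (hvu j i)
  have split : ∀ y : L, (∀ a ∈ nestSpan u, ⁅y, a⁆ ∈ S) → (∀ a ∈ H, ⁅y, a⁆ ∈ S) →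
      (∀ a ∈ nestSpan v, ⁅y, a⁆ ∈ S) → ∀ x ∈ S, ⁅y, x⁆ ∈ S := by
    intro y h1 h2 h3 x hx
    obtain ⟨p, hp, c, hc, rfl⟩ := Submodule.mem_sup.mp hx
    obtain ⟨a, ha, b, hb, rfl⟩ := Submodule.mem_sup.mp hp
    rw [lie_add, lie_add]
    exact S.add_mem (S.add_mem (h1 a ha) (h2 b hb)) (h3 c hc)
  have hgenH : ∀ (t : ι → L), nestSpan t ≤ S → (∀ y ∈ H, ∀ i, ∃ c : ℂ, ⁅y, t i⁆ = c • t i) →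
      ∀ i, ∀ a ∈ H, ⁅t i, a⁆ ∈ S := by
    intro t ht h1 i a ha
    obtain ⟨c, hc⟩ := h1 a ha i
    rw [← lie_skew, hc]
    exact S.neg_mem (S.smul_mem _ (ht (nest_mem t i [])))
  -- The elements whose bracket maps `S` into itself form a subalgebra. It contains the generators,
  -- hence is everything, so `S` is itself a subalgebra containing the generators.
  let K : LieSubalgebra ℂ L :=
    { carrier := {y | ∀ x ∈ S, ⁅y, x⁆ ∈ S}
      add_mem' := fun ha hb x hx => by rw [add_lie]; exact S.add_mem (ha x hx) (hb x hx)
      zero_mem' := fun x _ => by simp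
      smul_mem' := fun c a ha x hx => by rw [smul_lie]; exact S.smul_mem c (ha x hx)
      lie_mem' := fun {a b} ha hb x hx => by
        rw [lie_lie]; exact S.sub_mem (ha _ (hb x hx)) (hb _ (ha x hx)) }
  have hK : K = ⊤ := hgen K
    (fun i => split _ (fun a ha => huS (lie_gen_mem_nestSpan u i ha)) (hgenH u huS hHu i)
      (fun a ha => hvHS (lie_opp_mem hHv huv i ha)))
    (fun i => split _ (fun a ha => huHS (lie_opp_mem hHu hvu i ha)) (hgenH v hvS hHv i)
      (fun a ha => hvS (lie_gen_mem_nestSpan v i ha)))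
    (fun y hy => split _ (fun a ha => huS (lie_cartan_mem_nestSpan (hHu y hy) ha))
      (fun a ha => by rw [hHH y hy a ha]; exact S.zero_mem)
      (fun a ha => hvS (lie_cartan_mem_nestSpan (hHv y hy) ha)))
  let T : LieSubalgebra ℂ L :=
    { S with lie_mem' := fun {a b} _ hb => (hK ▸ LieSubalgebra.mem_top a : a ∈ K) b hb }
  have hT : T = ⊤ := hgen T (fun i => huS (nest_mem u i [])) (fun i => hvS (nest_mem v i []))
    fun y hy => hHS hy
  exact congrArg LieSubalgebra.toSubmodule hT

end Nested

/-! ### Triangular decomposition and root spaces of the Kac–Moody algebra. -/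

variable {l : ℕ} {A : Matrix (Fin l) (Fin l) ℤ} {h : Type*} [AddCommGroup h] [Module ℂ h]
  (R : Realization A h)

/-- The projection of the free Lie algebra onto `g`. -/
noncomputable def proj : FreeKM l h →ₗ⁅ℂ⁆ KMAlg R where
  toFun := LieSubmodule.Quotient.mk (N := relIdeal R)
  map_add' _ _ := rfl
  map_smul' _ _ := rfl
  map_lie' := rfl

theorem proj_surjective : Function.Surjective (proj R) :=
  LieSubmodule.Quotient.surjective_mk' (relIdeal R)

variable {R} in
theorem proj_eq_zero {x : FreeKM l h} (hx : Rel R x) : proj R x = 0 :=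
  (LieSubmodule.Quotient.mk_eq_zero (N := relIdeal R)).mpr (LieSubmodule.subset_lieSpan hx)

/-- The image of `e_i` in `g`. -/
noncomputable def genE (i : Fin l) : KMAlg R := proj R (fE h i)

/-- The image of `f_i` in `g`. -/
noncomputable def genF (i : Fin l) : KMAlg R := proj R (fF h i)

/-- The map from `h` to `g`. -/
noncomputable def cartanLin : h →ₗ[ℂ] KMAlg R where
  toFun := cartan R
  map_add' x y := by
    have := proj_eq_zero (Rel.add (R := R) x y)
    rw [map_sub, map_add, sub_eq_zero] at this
    exact this
  map_smul' c x := by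
    have := proj_eq_zero (Rel.smul (R := R) c x)
    rw [map_sub, map_smul, sub_eq_zero] at this
    exact this

theorem cartan_lie_cartan (x y : h) : ⁅cartan R x, cartan R y⁆ = 0 := by
  have := proj_eq_zero (Rel.hh (R := R) x y)
  rwa [LieHom.map_lie] at this

theorem cartan_lie_genE (x : h) (i : Fin l) : ⁅cartan R x, genE R i⁆ = R.root i x • genE R i := by
  have := proj_eq_zero (Rel.he (R := R) x i)
  rw [map_sub, map_smul, LieHom.map_lie, sub_eq_zero] at this
  exact this

theorem cartan_lie_genF (x : h) (i : Fin l) :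
    ⁅cartan R x, genF R i⁆ = (-R.root i) x • genF R i := by
  have := proj_eq_zero (Rel.hf (R := R) x i)
  rw [map_add, map_smul, LieHom.map_lie, add_eq_zero_iff_eq_neg, ← neg_smul] at this
  exact this

theorem genF_lie_genE_mem (i j : Fin l) :
    ⁅genF R i, genE R j⁆ ∈ LinearMap.range (cartanLin R) := by
  rw [← lie_skew]
  refine Submodule.neg_mem _ ?_
  by_cases hij : j = i
  · subst hij
    have := proj_eq_zero (Rel.ef_same (R := R) j)
    rw [map_sub, LieHom.map_lie, sub_eq_zero] at this
    exact ⟨R.coroot j, this.symm⟩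
  · have := proj_eq_zero (Rel.ef_ne (R := R) j i hij)
    rw [LieHom.map_lie] at this
    exact ⟨0, by rw [map_zero]; exact this.symm⟩

theorem eq_top_of_gen_mem (K : LieSubalgebra ℂ (KMAlg R)) (hE : ∀ i, genE R i ∈ K)
    (hF : ∀ i, genF R i ∈ K) (hH : ∀ x, cartan R x ∈ K) : K = ⊤ := by
  let g : KMGen l h → K
    | .H x => ⟨cartan R x, hH x⟩
    | .E i => ⟨genE R i, hE i⟩
    | .F i => ⟨genF R i, hF i⟩
  have hcomp : K.incl.comp (FreeLieAlgebra.lift ℂ g) = proj R := by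
    apply FreeLieAlgebra.hom_ext
    intro x
    rw [LieHom.comp_apply, FreeLieAlgebra.lift_of_apply]
    cases x <;> rfl
  rw [eq_top_iff]
  intro y _
  obtain ⟨z, rfl⟩ := proj_surjective R y
  rw [← hcomp]
  exact (FreeLieAlgebra.lift ℂ g z).2

theorem triangular_decomposition :
    nestSpan (genE R) ⊔ LinearMap.range (cartanLin R) ⊔ nestSpan (genF R) = ⊤ := by
  refine triangular_eq_top ?_ ?_ ?_ (genF_lie_genE_mem R) ?_
  · rintro _ ⟨x, rfl⟩ i
    exact ⟨_, cartan_lie_genE R x i⟩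
  · rintro _ ⟨x, rfl⟩ i
    exact ⟨_, cartan_lie_genF R x i⟩
  · rintro _ ⟨x, rfl⟩ _ ⟨y, rfl⟩
    exact cartan_lie_cartan R x y
  · intro K h1 h2 h3
    exact eq_top_of_gen_mem R K h1 h2 fun x => h3 _ ⟨x, rfl⟩

/-- Weight spaces sit inside the simultaneous generalized eigenspaces of a commuting family, which
are independent. -/
theorem wtSpace_independent : iSupIndep (wtSpace R (KMAlg R)) := by
  have hcomm : ∀ x y : h, Commute (LieModule.toEnd ℂ (KMAlg R) (KMAlg R) (cartan R x))
      (LieModule.toEnd ℂ (KMAlg R) (KMAlg R) (cartan R y)) := by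
    intro x y
    ext z
    change ⁅cartan R x, ⁅cartan R y, z⁆⁆ = ⁅cartan R y, ⁅cartan R x, z⁆⁆
    rw [leibniz_lie, cartan_lie_cartan, zero_lie, zero_add]
  have h1 := Module.End.independent_iInf_maxGenEigenspace_of_forall_mapsTo
    (fun x : h => LieModule.toEnd ℂ (KMAlg R) (KMAlg R) (cartan R x))
    fun x y φ => Module.End.mapsTo_maxGenEigenspace_of_comm (hcomm y x) φ
  refine (h1.comp (f := fun μ : Module.Dual ℂ h => (μ : h → ℂ)) DFunLike.coe_injective).mono ?_
  intro μ v hv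
  rw [Function.comp_apply, Submodule.mem_iInf]
  intro x
  refine Module.End.mem_maxGenEigenspace _ _ _ |>.mpr ⟨1, ?_⟩
  have : ⁅cartan R x, v⁆ = μ x • v := hv x
  simp [this]

/-- By the modular law, a spanning family of subspaces of independent summands must fill each
summand. -/
theorem eq_of_iSupIndep_of_iSup_eq_top {ι M : Type*} [AddCommGroup M] [Module ℂ M]
    {B C : ι → Submodule ℂ M} (hB : iSupIndep B) (hCB : C ≤ B) (hC : ⨆ i, C i = ⊤) (i : ι) :
    B i = C i := by
  refine le_antisymm ?_ (hCB i)
  have h1 : C i ⊔ ⨆ (j) (_ : j ≠ i), C j = ⊤ := by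
    rw [← hC, ← iSup_split_single]
  have h2 : B i ⊓ ⨆ (j) (_ : j ≠ i), C j = ⊥ := by
    refine le_bot_iff.mp (le_trans ?_ (hB i).le_bot)
    gcongr with j
    exact hCB j
  calc B i = (C i ⊔ ⨆ (j) (_ : j ≠ i), C j) ⊓ B i := by rw [h1, top_inf_eq]
    _ = C i ⊔ (⨆ (j) (_ : j ≠ i), C j) ⊓ B i := sup_inf_assoc_of_le _ (hCB i)
    _ ≤ C i := by rw [inf_comm, h2, sup_bot_eq]

/-- The scalar `c` is `1` for the `e_i` and `-1` for the `f_i`, so that both halves are treated at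
once. -/
theorem nest_mem_wtSpace {u : Fin l → KMAlg R} {c : ℂ}
    (hu : ∀ i, u i ∈ wtSpace R (KMAlg R) (c • R.root i)) (i : Fin l) (w : List (Fin l)) :
    nest u i w ∈ wtSpace R (KMAlg R) (c • ((i :: w).map R.root).sum) := by
  induction w with
  | nil => simpa [nest] using hu i
  | cons j w ih =>
    have := StdGrading.lie_mem_wtSpace (hu j) ih
    rw [List.map_cons, List.sum_cons] at this
    have e : c • ((i :: j :: w).map R.root).sum =
        c • R.root j + c • (R.root i + (w.map R.root).sum) := by
      simp only [List.map_cons, List.sum_cons, smul_add]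
      abel
    rw [e]
    exact this

/-- Independence of the simple roots provides a functional with value 1 on each of them. It measures
word length, so the weight fixes the length, and the alphabet is finite. -/
theorem finite_words (c : ℂ) (hc : c ≠ 0) (α : Module.Dual ℂ h) :
    {p : Fin l × List (Fin l) | c • ((p.1 :: p.2).map R.root).sum = α}.Finite := by
  obtain ⟨φ, hφ⟩ : ∃ φ : Module.Dual ℂ h →ₗ[ℂ] ℂ, ∀ i, φ (R.root i) = 1 := by
    obtain ⟨φ, hφ⟩ := LinearMap.exists_extend
      ((Finsupp.linearCombination ℂ fun _ : Fin l => (1 : ℂ)) ∘ₗ R.root_indep.repr)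
    refine ⟨φ, fun i => ?_⟩
    have h1 := congrArg (fun T => T ⟨R.root i, Submodule.subset_span ⟨i, rfl⟩⟩) hφ
    have h2 := R.root_indep.repr_eq_single i ⟨R.root i, Submodule.subset_span ⟨i, rfl⟩⟩ rfl
    simpa [h2] using h1
  have hlen : ∀ w : List (Fin l), φ (w.map R.root).sum = w.length := by
    intro w
    induction w with
    | nil => simp
    | cons j w ih => simp [hφ, ih, add_comm]
  have hinj : Function.Injective fun p : Fin l × List (Fin l) => p.1 :: p.2 := by
    rintro ⟨i, w⟩ ⟨j, w'⟩ hp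
    simpa using hp
  rcases Set.eq_empty_or_nonempty
    {p : Fin l × List (Fin l) | c • ((p.1 :: p.2).map R.root).sum = α} with he | ⟨p, hp⟩
  · rw [he]; exact Set.finite_empty
  · refine ((List.finite_length_eq (Fin l) (p.1 :: p.2).length).preimage hinj.injOn).subset ?_
    intro q hq
    have h1 : φ (c • ((q.1 :: q.2).map R.root).sum) = φ (c • ((p.1 :: p.2).map R.root).sum) := by
      rw [show c • ((q.1 :: q.2).map R.root).sum = α from hq,
        show c • ((p.1 :: p.2).map R.root).sum = α from hp]
    rw [map_smul, map_smul, hlen, hlen] at h1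
    have h2 := mul_left_cancel₀ hc h1
    exact_mod_cast h2

/-- The span of the nested brackets of weight `α`. -/
noncomputable def nestWt (u : Fin l → KMAlg R) (c : ℂ) (α : Module.Dual ℂ h) : Submodule ℂ (KMAlg R) :=
  Submodule.span ℂ ((fun p : Fin l × List (Fin l) => nest u p.1 p.2) ''
    {p | c • ((p.1 :: p.2).map R.root).sum = α})

theorem nestWt_finite (u : Fin l → KMAlg R) {c : ℂ} (hc : c ≠ 0) (α : Module.Dual ℂ h) :
    Module.Finite ℂ (nestWt R u c α) :=
  Module.Finite.span_of_finite ℂ ((finite_words R c hc α).image _)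

theorem nestWt_le {u : Fin l → KMAlg R} {c : ℂ}
    (hu : ∀ i, u i ∈ wtSpace R (KMAlg R) (c • R.root i)) (α : Module.Dual ℂ h) :
    nestWt R u c α ≤ wtSpace R (KMAlg R) α := by
  refine Submodule.span_le.mpr ?_
  rintro _ ⟨p, hp, rfl⟩
  have := nest_mem_wtSpace R hu p.1 p.2
  rwa [show c • ((p.1 :: p.2).map R.root).sum = α from hp] at this

theorem nestSpan_le (u : Fin l → KMAlg R) (c : ℂ) : nestSpan u ≤ ⨆ α, nestWt R u c α := by
  refine Submodule.span_le.mpr ?_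
  rintro _ ⟨p, rfl⟩
  exact Submodule.mem_iSup_of_mem (c • ((p.1 :: p.2).map R.root).sum)
    (Submodule.subset_span ⟨p, rfl, rfl⟩)

open Classical in
/-- The root spaces of a Kac--Moody algebra are finite dimensional. -/
theorem wtSpace_finite (α : Module.Dual ℂ h) : Module.Finite ℂ (wtSpace R (KMAlg R) α) := by
  have := R.finite
  let C : Module.Dual ℂ h → Submodule ℂ (KMAlg R) := fun β =>
    nestWt R (genE R) 1 β ⊔ (if β = 0 then LinearMap.range (cartanLin R) else ⊥) ⊔
      nestWt R (genF R) (-1) β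
  have hE : ∀ i, genE R i ∈ wtSpace R (KMAlg R) ((1 : ℂ) • R.root i) := fun i x => by
    rw [one_smul]; exact cartan_lie_genE R x i
  have hF : ∀ i, genF R i ∈ wtSpace R (KMAlg R) ((-1 : ℂ) • R.root i) := fun i x => by
    rw [neg_one_smul]; exact cartan_lie_genF R x i
  have hCB : C ≤ wtSpace R (KMAlg R) := by
    intro β
    refine sup_le (sup_le (nestWt_le R hE β) ?_) (nestWt_le R hF β)
    split_ifs with hβ
    · rintro _ ⟨y, rfl⟩ x
      rw [hβ]
      change ⁅cartan R x, cartan R y⁆ = (0 : ℂ) • _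
      rw [zero_smul, cartan_lie_cartan]
    · exact bot_le
  have hC : ⨆ β, C β = ⊤ := by
    rw [eq_top_iff, ← triangular_decomposition R]
    refine sup_le (sup_le ?_ ?_) ?_
    · exact (nestSpan_le R _ 1).trans (iSup_mono fun β => le_sup_left.trans le_sup_left)
    · refine le_trans ?_ (le_iSup C 0)
      simp only [C, if_true]
      exact le_sup_right.trans le_sup_left
    · exact (nestSpan_le R _ (-1)).trans (iSup_mono fun β => le_sup_right)
  rw [eq_of_iSupIndep_of_iSup_eq_top (wtSpace_independent R) hCB hC α]
  have h1 := nestWt_finite R (genE R) one_ne_zero α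
  have h2 := nestWt_finite R (genF R) (neg_ne_zero.mpr one_ne_zero) α
  have h3 : Module.Finite ℂ
      (if α = 0 then LinearMap.range (cartanLin R) else ⊥ : Submodule ℂ (KMAlg R)) := by
    by_cases hα : α = 0
    · rw [if_pos hα]
      infer_instance
    · rw [if_neg hα]
      infer_instance
  infer_instance

end KacMoody

namespace KacMoody

open FilteredExp

/-! ### The filtration of the operators on a positive completion -/

section Operators

variable {M : Type*} [AddCommGroup M] [Module ℂ M] {W : ℤ → Submodule ℂ M}

theorem OrdGE.add {k : ℤ} {v w : PosCompletion W} (hv : OrdGE k v) (hw : OrdGE k w) :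
    OrdGE k (v + w) := fun m hm => by
  change v.1 m + w.1 m = 0
  rw [hv m hm, hw m hm, add_zero]

theorem OrdGE.smul {k : ℤ} {v : PosCompletion W} (c : ℂ) (hv : OrdGE k v) :
    OrdGE k (c • v) := fun m hm => by
  change c • v.1 m = 0
  rw [hv m hm, smul_zero]

theorem OrdGE.sub {k : ℤ} {v w : PosCompletion W} (hv : OrdGE k v) (hw : OrdGE k w) :
    OrdGE k (v - w) := fun m hm => by
  change v.1 m - w.1 m = 0
  rw [hv m hm, hw m hm, sub_zero]

noncomputable instance endRing : Ring (Module.End ℂ (PosCompletion W)) := inferInstance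

noncomputable instance endAddCommGroup : AddCommGroup (Module.End ℂ (PosCompletion W)) :=
  Ring.toAddCommGroup

noncomputable instance endAddCommMonoid : AddCommMonoid (Module.End ℂ (PosCompletion W)) :=
  AddCommGroup.toAddCommMonoid

noncomputable instance endAlgebra : Algebra ℂ (Module.End ℂ (PosCompletion W)) := inferInstance

noncomputable instance endModule : Module ℂ (Module.End ℂ (PosCompletion W)) := Algebra.toModule

variable (W) in
/-- The operators that raise the order by at least `j`. -/
def raiseFilt (j : ℕ) : Submodule ℂ (Module.End ℂ (PosCompletion W)) where
  carrier := {T | ∀ k v, OrdGE k v → OrdGE (k + j) (T v)}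
  add_mem' hS hT k v hv := (hS k v hv).add (hT k v hv)
  zero_mem' _ _ _ _ _ := rfl
  smul_mem' c _ hT k v hv := (hT k v hv).smul c

theorem raiseFilt_isFiltration :
    IsFiltration (E := Module.End ℂ (PosCompletion W)) (raiseFilt W) where
  one_mem k v hv := by simpa using hv
  mul_mem := by
    intro i j a b ha hb k v hv
    have := ha _ _ (hb k v hv)
    push_cast
    rwa [add_comm (i : ℤ), ← add_assoc]
  anti i j hij T hT k v hv := (hT k v hv).mono (by omega)
  sep := by
    intro T hT
    ext v : 1
    obtain ⟨N, hN⟩ := v.2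
    apply Subtype.ext
    funext m
    -- Raising order `N` by `m - N + 1` moves past degree `m`.
    exact hT (m - N + 1).toNat N v hN m (by omega)

theorem raises_iff_mem {T : Module.End ℂ (PosCompletion W)} : Raises T ↔ T ∈ raiseFilt W 1 := by
  simp [Raises, raiseFilt]

theorem isExp_proExp {T : Module.End ℂ (PosCompletion W)} (hT : Raises T) :
    IsExp (raiseFilt W) T (proExp T hT).toLinearMap := by
  refine ⟨fun j => Submodule.smul_mem _ _
    (raiseFilt_isFiltration.pow_mem (raises_iff_mem.mp hT) j), fun j k v hv => ?_⟩
  have := proSeries_ordGE_sub (fun j => ((j.factorial : ℂ))⁻¹) T hT hv j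
  convert this using 1
  simp only [LinearMap.sub_apply, LinearMap.sum_apply, LinearMap.smul_apply]
  rfl

variable (W) in
/-- The operator that multiplies the component of degree `m` by `m`. -/
def degOp : Module.End ℂ (PosCompletion W) where
  toFun v := ⟨fun m => (m : ℂ) • v.1 m, by
    obtain ⟨N, hN⟩ := v.2
    exact ⟨N, fun m hm => by simp [hN m hm]⟩⟩
  map_add' u v := by
    apply Subtype.ext
    funext m
    exact smul_add _ _ _
  map_smul' c v := by
    apply Subtype.ext
    funext m
    exact smul_comm (m : ℂ) c (v.1 m)

theorem degOp_apply (v : PosCompletion W) (m : ℤ) : (degOp W v).1 m = (m : ℂ) • v.1 m := rfl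

theorem degOp_mem : degOp W ∈ raiseFilt W 0 := by
  intro k v hv m hm
  rw [degOp_apply, hv m (by simpa using hm), smul_zero]

/-- The leading part of `T` is homogeneous of degree `j`, and on such an operator `[d, ·]` is
multiplication by `j`. -/
theorem der_degOp_sub_mem (j : ℕ) (T : Module.End ℂ (PosCompletion W)) (hT : T ∈ raiseFilt W j) :
    der (degOp W) T - (j : ℂ) • T ∈ raiseFilt W (j + 1) := by
  intro k v hv m hm
  -- On vectors of order at least `k`, the degree operator is the scalar `k` up to order `k + 1`.
  have h1 : OrdGE (k + 1) (degOp W v - (k : ℂ) • v) := by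
    intro i hi
    change (i : ℂ) • v.1 i - (k : ℂ) • v.1 i = 0
    rcases (show i ≤ k by omega).lt_or_eq with h | h
    · rw [hv i h, smul_zero, smul_zero, sub_zero]
    · rw [h, sub_self]
  have h2 := hT _ _ h1 m (by push_cast at hm; omega)
  rw [map_sub, map_smul] at h2
  change (T (degOp W v)).1 m - (k : ℂ) • (T v).1 m = 0 at h2
  change ((m : ℂ) • (T v).1 m - (T (degOp W v)).1 m) - (j : ℂ) • (T v).1 m = 0
  rw [sub_eq_zero.mp h2, ← sub_smul, ← sub_smul]
  rcases (show m ≤ k + j by push_cast at hm; omega).lt_or_eq with h | h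
  · rw [hT k v hv m h, smul_zero]
  · rw [h]
    push_cast
    rw [show (k + j - k - j : ℂ) = 0 by ring, zero_smul]

/-- The family with the single component `v` in degree `j`. -/
def single (j : ℤ) (v : W j) : PosCompletion W :=
  ⟨Pi.single (M := fun m => W m) j v, j,
    fun _ hm => Pi.single_eq_of_ne (M := fun m => W m) (ne_of_lt hm) v⟩

theorem single_same (j : ℤ) (v : W j) : (single j v).1 j = v :=
  Pi.single_eq_same (M := fun m => W m) j v

theorem single_of_ne {j i : ℤ} (v : W j) (hij : i ≠ j) : (single j v).1 i = 0 :=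
  Pi.single_eq_of_ne (M := fun m => W m) hij v

theorem single_ordGE (j : ℤ) (v : W j) : OrdGE j (single j v) :=
  fun _ hm => single_of_ne v (by omega)

theorem single_zero (j : ℤ) : single j (0 : W j) = 0 :=
  Subtype.ext (Pi.single_zero (M := fun m => W m) j)

end Operators

/-! ### The completed Lie algebra as a complete Lie algebra of operators. -/

namespace StdGrading

variable {l : ℕ} {A : Matrix (Fin l) (Fin l) ℤ} {h : Type*} [AddCommGroup h] [Module ℂ h]
  {R : Realization A h} {V : Type*} [AddCommGroup V] [Module ℂ V]
  [LieRingModule (KMAlg R) V] [LieModule ℂ (KMAlg R) V]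
  {P : AddSubgroup (Module.Dual ℂ h)} (G : StdGrading R V P)

theorem lie_mem_gPiece {k j : ℤ} {x y : KMAlg R} (hx : x ∈ G.gPiece k) (hy : y ∈ G.gPiece j) :
    ⁅x, y⁆ ∈ G.gPiece (k + j) := by
  let B : KMAlg R →ₗ[ℂ] KMAlg R →ₗ[ℂ] KMAlg R :=
    (LieModule.toEnd ℂ (KMAlg R) (KMAlg R) : KMAlg R →ₗ[ℂ] _)
  suffices hB : Submodule.map₂ B (G.gPiece k) (G.gPiece j) ≤ G.gPiece (k + j) from
    hB (Submodule.apply_mem_map₂ B hx hy)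
  simp only [gPiece, Submodule.map₂_iSup_left, Submodule.map₂_iSup_right, iSup_le_iff]
  intro β hβ α hα
  rw [Submodule.map₂_le]
  intro y hy w hw
  have hyw : ⁅y, w⁆ ∈ wtSpace R (KMAlg R) (α + β) := lie_mem_wtSpace hy hw
  change ⁅y, w⁆ ∈ _
  by_cases h0 : ⁅y, w⁆ = 0
  · rw [h0]
    exact Submodule.zero_mem _
  · obtain ⟨-, hαP, hfα⟩ := hα
    obtain ⟨-, hβP, hfβ⟩ := hβ
    have hmem : α + β ∈ degSet G.f (roots R ∪ {0}) (k + j) := by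
      refine ⟨?_, P.add_mem hαP hβP, ?_⟩
      · by_cases h1 : α + β = 0
        · exact Or.inr h1
        · refine Or.inl ⟨h1, fun hbot => h0 ?_⟩
          rw [hbot] at hyw
          exact (Submodule.mem_bot ℂ).mp hyw
      · rw [← hfα, ← hfβ, ← map_add]
        rfl
    exact Submodule.mem_iSup_of_mem (α + β) (Submodule.mem_iSup_of_mem hmem hyw)

theorem iSup_vPiece : ⨆ m, G.vPiece m = ⊤ := by
  rw [eq_top_iff, ← G.isWeightModule.diagonalizable]
  refine iSup_le fun μ => ?_
  by_cases hμ : wtSpace R V μ = ⊥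
  · rw [hμ]; exact bot_le
  · have hP : μ ∈ P := G.wts_subset hμ
    refine le_trans ?_ (le_iSup _ (G.f ⟨μ, hP⟩))
    exact le_iSup₂_of_le μ (⟨hμ, hP, rfl⟩ : μ ∈ degSet G.f (wts R V) (G.f ⟨μ, hP⟩)) le_rfl

theorem gPiece_finite (m : ℤ) : Module.Finite ℂ (G.gPiece m) := by
  have := (G.finite_roots m).to_subtype
  have := wtSpace_finite R
  rw [gPiece, iSup_subtype']
  infer_instance

theorem vPiece_finite (m : ℤ) : Module.Finite ℂ (G.vPiece m) := by
  have := (G.finite_wts m).to_subtype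
  have := G.isWeightModule.finite
  rw [vPiece, iSup_subtype']
  infer_instance

theorem rhoHat_apply (x : G.gHat) (v : G.vHat) (m : ℤ) :
    ((G.rhoHat x v).1 m : V) = ∑ᶠ k : ℤ, ⁅(x.1 k : KMAlg R), (v.1 (m - k) : V)⁆ := rfl

/-- The extended representation, as a linear map. -/
noncomputable def rhoLin : G.gHat →ₗ[ℂ] Module.End ℂ G.vHat where
  toFun := G.rhoHat
  map_add' x y := by
    ext v : 1
    apply Subtype.ext
    funext m
    apply Subtype.ext
    change (∑ᶠ k : ℤ, ⁅((x + y).1 k : KMAlg R), (v.1 (m - k) : V)⁆) =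
      (∑ᶠ k : ℤ, ⁅(x.1 k : KMAlg R), (v.1 (m - k) : V)⁆) +
        ∑ᶠ k : ℤ, ⁅(y.1 k : KMAlg R), (v.1 (m - k) : V)⁆
    rw [← finsum_add_distrib (G.rho_finite x v m) (G.rho_finite y v m)]
    refine finsum_congr fun k => ?_
    rw [← add_lie]
    rfl
  map_smul' c x := by
    ext v : 1
    apply Subtype.ext
    funext m
    apply Subtype.ext
    change (∑ᶠ k : ℤ, ⁅((c • x).1 k : KMAlg R), (v.1 (m - k) : V)⁆) =
      c • ∑ᶠ k : ℤ, ⁅(x.1 k : KMAlg R), (v.1 (m - k) : V)⁆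
    rw [smul_finsum]
    refine finsum_congr fun k => ?_
    rw [← smul_lie]
    rfl

theorem rhoLin_apply (x : G.gHat) : G.rhoLin x = G.rhoHat x := rfl

theorem rhoLin_sub (x y : G.gHat) : G.rhoLin (x - y) = G.rhoLin x - G.rhoLin y :=
  map_sub G.rhoLin x y

theorem rhoLin_single_apply {j : ℤ} (a : G.gPiece j) (v : G.vHat) (m : ℤ) :
    ((G.rhoLin (single j a) v).1 m : V) = ⁅(a : KMAlg R), (v.1 (m - j) : V)⁆ := by
  rw [rhoLin_apply, rhoHat_apply, finsum_eq_single _ j, single_same]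
  intro k hk
  rw [single_of_ne a hk]
  simp

theorem rhoLin_apply_single (x : G.gHat) {j : ℤ} (v : G.vPiece j) (k : ℤ) :
    ((G.rhoLin x (single j v)).1 (k + j) : V) = ⁅(x.1 k : KMAlg R), (v : V)⁆ := by
  rw [rhoLin_apply, rhoHat_apply, finsum_eq_single _ k, add_sub_cancel_left, single_same]
  intro i hi
  rw [single_of_ne v (by omega)]
  simp

theorem rhoLin_mem {x : G.gHat} {j : ℕ} (hx : x ∈ G.nHat j) :
    G.rhoLin x ∈ raiseFilt G.vPiece j := by
  intro K v hv m hm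
  apply Subtype.ext
  change (∑ᶠ k : ℤ, ⁅(x.1 k : KMAlg R), (v.1 (m - k) : V)⁆) = 0
  refine finsum_eq_zero_of_forall_eq_zero fun k => ?_
  rcases lt_or_ge k j with h1 | h1
  · simp [hx k h1]
  · simp [hv (m - k) (by omega)]

/-- On a homogeneous `v` of degree `m`, the component of `ρ(x) v` in degree `k + m` is exactly `x_k
v`. If it vanishes on all `V_m`, which span `V`, then faithfulness forces `x_k = 0`. -/
theorem mem_nHat_of_rhoLin_mem (hV : LieModule.IsFaithful ℂ (KMAlg R) V) {x : G.gHat} {j : ℕ}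
    (hx : G.rhoLin x ∈ raiseFilt G.vPiece j) : x ∈ G.nHat j := by
  intro k hk
  have h1 : ∀ v : V, ⁅(x.1 k : KMAlg R), v⁆ = 0 := by
    have h2 : ⨆ m, G.vPiece m ≤
        LinearMap.ker (LieModule.toEnd ℂ (KMAlg R) V (x.1 k : KMAlg R)) := by
      refine iSup_le fun m v hv => ?_
      have h3 := G.rhoLin_apply_single x (⟨v, hv⟩ : G.vPiece m) k
      rw [hx m _ (single_ordGE m _) (k + m) (by omega)] at h3
      exact h3.symm
    rw [iSup_vPiece] at h2
    exact fun v => h2 (Submodule.mem_top (x := v))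
  refine Subtype.ext (hV.injective_toEnd ?_)
  rw [Submodule.coe_zero, map_zero]
  ext v
  exact h1 v

theorem rhoLin_sub_sum_mem {x : G.gHat} (hx : x ∈ G.nHat 0) (j : ℕ) :
    G.rhoLin x - ∑ i ∈ Finset.range j, G.rhoLin (single (i : ℤ) (x.1 i)) ∈
      raiseFilt G.vPiece j := by
  rw [← map_sum, ← rhoLin_sub]
  refine G.rhoLin_mem fun k hk => ?_
  have h1 : (∑ i ∈ Finset.range j, single (i : ℤ) (x.1 i) : G.gHat).1 k =
      ∑ i ∈ Finset.range j, (single (i : ℤ) (x.1 i) : G.gHat).1 k := by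
    simp
  change x.1 k - (∑ i ∈ Finset.range j, single (i : ℤ) (x.1 i) : G.gHat).1 k = 0
  rw [h1]
  rcases lt_or_ge k 0 with h0 | h0
  · rw [hx k h0, Finset.sum_eq_zero, sub_zero]
    intro i _
    exact single_of_ne _ (by omega)
  · lift k to ℕ using h0
    rw [Finset.sum_eq_single k, single_same, sub_self]
    · intro i _ hi
      exact single_of_ne _ (by omega)
    · intro hk'
      exact absurd (Finset.mem_range.mpr (by omega)) hk'

theorem rhoLin_single_commutator {a b : ℤ} (u : G.gPiece a) (w : G.gPiece b) :
    G.rhoLin (single a u) * G.rhoLin (single b w) - G.rhoLin (single b w) * G.rhoLin (single a u) =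
      G.rhoLin (single (a + b) ⟨⁅(u : KMAlg R), (w : KMAlg R)⁆, G.lie_mem_gPiece u.2 w.2⟩) := by
  ext v : 1
  apply Subtype.ext
  funext m
  apply Subtype.ext
  rw [rhoLin_single_apply]
  change ((G.rhoLin (single a u) (G.rhoLin (single b w) v)).1 m : V) -
    ((G.rhoLin (single b w) (G.rhoLin (single a u) v)).1 m : V) = _
  rw [rhoLin_single_apply, rhoLin_single_apply, rhoLin_single_apply, rhoLin_single_apply,
    sub_sub, sub_sub, add_comm b a, lie_lie]

theorem der_rhoLin (x : G.gHat) :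
    der (degOp G.vPiece) (G.rhoLin x) = G.rhoLin (degOp G.gPiece x) := by
  ext v : 1
  apply Subtype.ext
  funext m
  apply Subtype.ext
  change (m : ℂ) • (∑ᶠ k : ℤ, ⁅(x.1 k : KMAlg R), (v.1 (m - k) : V)⁆) -
    (∑ᶠ k : ℤ, ⁅(x.1 k : KMAlg R), ((degOp G.vPiece v).1 (m - k) : V)⁆) =
      ∑ᶠ k : ℤ, ⁅((degOp G.gPiece x).1 k : KMAlg R), (v.1 (m - k) : V)⁆
  have hfin : (Function.support fun k : ℤ =>
      (m : ℂ) • ⁅(x.1 k : KMAlg R), (v.1 (m - k) : V)⁆).Finite :=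
    (G.rho_finite x v m).subset (Function.support_const_smul_subset _ _)
  rw [smul_finsum, ← finsum_sub_distrib hfin (G.rho_finite x (degOp G.vPiece v) m)]
  refine finsum_congr fun k => ?_
  rw [degOp_apply, degOp_apply, Submodule.coe_smul, Submodule.coe_smul, lie_smul, smul_lie,
    ← sub_smul]
  push_cast
  rw [sub_sub_cancel]

/-- The image of `∏_{k ≥ n} g_k` in the operators on the completion of `V`. -/
noncomputable def opHat (n : ℕ) : Submodule ℂ (Module.End ℂ G.vHat) :=
  (G.nHat n).map G.rhoLin

/-- The bracket of the completion is not constructed. The commutator is the limit of commutators of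
finite partial sums, each lying in the image by `rhoLin_single_commutator`, so completeness
suffices. -/
theorem mul_sub_mul_mem_opHat {n : ℕ}
    (hcomplete : ∀ s : ℕ → Module.End ℂ G.vHat, (∀ j, s j ∈ G.opHat n) →
      (∀ j, s (j + 1) - s j ∈ raiseFilt G.vPiece j) →
      ∃ t ∈ G.opHat n, ∀ j, t - s j ∈ raiseFilt G.vPiece j)
    {x y : G.gHat} (hx : x ∈ G.nHat n) (hy : y ∈ G.nHat n) :
    G.rhoLin x * G.rhoLin y - G.rhoLin y * G.rhoLin x ∈ G.opHat n := by
  have hF := raiseFilt_isFiltration (W := G.vPiece)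
  let X : ℕ → Module.End ℂ G.vHat := fun j =>
    ∑ i ∈ Finset.range j, G.rhoLin (single (i : ℤ) (x.1 i))
  let Y : ℕ → Module.End ℂ G.vHat := fun j =>
    ∑ i ∈ Finset.range j, G.rhoLin (single (i : ℤ) (y.1 i))
  have hX : ∀ j, G.rhoLin x - X j ∈ raiseFilt G.vPiece j :=
    G.rhoLin_sub_sum_mem (G.nHat_le (by omega) hx)
  have hY : ∀ j, G.rhoLin y - Y j ∈ raiseFilt G.vPiece j :=
    G.rhoLin_sub_sum_mem (G.nHat_le (by omega) hy)
  have hx0 : G.rhoLin x ∈ raiseFilt G.vPiece 0 :=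
    G.rhoLin_mem (G.nHat_le (by omega) hx)
  have hy0 : G.rhoLin y ∈ raiseFilt G.vPiece 0 :=
    G.rhoLin_mem (G.nHat_le (by omega) hy)
  have hY0 : ∀ j, Y j ∈ raiseFilt G.vPiece 0 := fun j => by
    have := sub_mem hy0 (hF.anti (Nat.zero_le j) (hY j))
    rwa [sub_sub_cancel] at this
  have hX0 : ∀ j, X j ∈ raiseFilt G.vPiece 0 := fun j => by
    have := sub_mem hx0 (hF.anti (Nat.zero_le j) (hX j))
    rwa [sub_sub_cancel] at this
  have happrox : ∀ j, (G.rhoLin x * G.rhoLin y - G.rhoLin y * G.rhoLin x) -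
      (X j * Y j - Y j * X j) ∈ raiseFilt G.vPiece j := by
    intro j
    have e : (G.rhoLin x * G.rhoLin y - G.rhoLin y * G.rhoLin x) - (X j * Y j - Y j * X j) =
        ((G.rhoLin x - X j) * G.rhoLin y + X j * (G.rhoLin y - Y j)) -
          ((G.rhoLin y - Y j) * G.rhoLin x + Y j * (G.rhoLin x - X j)) := by noncomm_ring
    rw [e]
    refine sub_mem (add_mem ?_ ?_) (add_mem ?_ ?_)
    · simpa using hF.mul_mem (hX j) hy0
    · simpa using hF.mul_mem (hX0 j) (hY j)
    · simpa using hF.mul_mem (hY j) hx0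
    · simpa using hF.mul_mem (hY0 j) (hX j)
  obtain ⟨t, ht, hts⟩ := hcomplete (fun j => X j * Y j - Y j * X j) (fun j => by
      have e : X j * Y j - Y j * X j = ∑ a ∈ Finset.range j, ∑ b ∈ Finset.range j,
          (G.rhoLin (single (a : ℤ) (x.1 a)) * G.rhoLin (single (b : ℤ) (y.1 b)) -
            G.rhoLin (single (b : ℤ) (y.1 b)) * G.rhoLin (single (a : ℤ) (x.1 a))) := by
        simp only [X, Y, Finset.sum_mul_sum, Finset.sum_sub_distrib]
        congr 1
        exact Finset.sum_comm
      rw [e]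
      refine sum_mem fun a _ => sum_mem fun b _ => ?_
      rcases lt_or_ge a n with ha | ha
      · rw [hx a (by exact_mod_cast ha), single_zero, map_zero, zero_mul, mul_zero, sub_zero]
        exact Submodule.zero_mem _
      · rw [rhoLin_single_commutator]
        exact ⟨_, fun i hi => single_ordGE _ _ i (by omega), rfl⟩)
    (fun j => by
      have := sub_mem (happrox j) (hF.anti (Nat.le_succ j) (happrox (j + 1)))
      rwa [sub_sub_sub_cancel_left] at this)
  have : G.rhoLin x * G.rhoLin y - G.rhoLin y * G.rhoLin x = t :=
    hF.eq_of_sub_mem fun j => by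
      have := sub_mem (happrox j) (hts j)
      rwa [sub_sub_sub_cancel_right] at this
  rwa [this]

/-- Faithfulness turns depth of operators into vanishing of components, so a Cauchy sequence of
operators comes from a sequence in which each component is eventually constant. -/
theorem opHat_complete (hV : LieModule.IsFaithful ℂ (KMAlg R) V) {n : ℕ}
    (s : ℕ → Module.End ℂ G.vHat) (hs : ∀ j, s j ∈ G.opHat n)
    (hc : ∀ j, s (j + 1) - s j ∈ raiseFilt G.vPiece j) :
    ∃ t ∈ G.opHat n, ∀ j, t - s j ∈ raiseFilt G.vPiece j := by
  choose x hx hxs using hs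
  have hd : ∀ j : ℕ, x (j + 1) - x j ∈ G.nHat j := fun j =>
    G.mem_nHat_of_rhoLin_mem hV (by rw [rhoLin_sub, hxs, hxs]; exact hc j)
  have hstable : ∀ (k : ℤ) (i j : ℕ), k < i → (x (i + j)).1 k = (x i).1 k := by
    intro k i j hk
    induction j with
    | zero => rfl
    | succ j ih =>
      rw [← ih]
      exact sub_eq_zero.mp (hd (i + j) k (by push_cast; omega))
  -- The component of degree `k` no longer changes from index `k + 1` on.
  let y : G.gHat := ⟨fun k => if k < n then 0 else (x (k.toNat + 1)).1 k, n, fun k hk => if_pos hk⟩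
  have hy : ∀ k : ℤ, y.1 k = if k < n then 0 else (x (k.toNat + 1)).1 k := fun _ => rfl
  refine ⟨G.rhoLin y, ⟨y, fun k hk => if_pos hk, rfl⟩, fun j => ?_⟩
  rw [← hxs, ← rhoLin_sub]
  refine G.rhoLin_mem fun k hk => ?_
  change y.1 k - (x j).1 k = 0
  rw [hy]
  split_ifs with h1
  · rw [hx j k h1, sub_zero]
  · obtain ⟨i, rfl⟩ := Nat.exists_eq_add_of_le (show k.toNat + 1 ≤ j by omega)
    rw [hstable k _ i (by omega), sub_self]

theorem opHat_isProLie (hV : LieModule.IsFaithful ℂ (KMAlg R) V) {n : ℕ} (hn : 1 ≤ n) :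
    IsProLie (raiseFilt G.vPiece) (degOp G.vPiece) (G.opHat n) where
  le := by
    rintro _ ⟨x, hx, rfl⟩
    exact G.rhoLin_mem (G.nHat_le (by exact_mod_cast hn) hx)
  der_mem := by
    rintro _ ⟨x, hx, rfl⟩
    refine ⟨degOp G.gPiece x, fun k hk => ?_, (G.der_rhoLin x).symm⟩
    rw [degOp_apply, hx k hk, smul_zero]
  lie_mem := by
    rintro _ ⟨x, hx, rfl⟩ _ ⟨y, hy, rfl⟩
    exact G.mul_sub_mul_mem_opHat (G.opHat_complete hV) hx hy
  complete := G.opHat_complete hV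

/-! ### Exponentials in the completed representation. -/

theorem isExp_expRho (x : G.nHat 1) :
    IsExp (raiseFilt G.vPiece) (G.rhoLin x.1) (G.expRho x).toLinearMap :=
  isExp_proExp (G.rhoHat_raises x)

theorem eq_expRho {x : G.nHat 1} {g : G.vHat ≃ₗ[ℂ] G.vHat}
    (hg : IsExp (raiseFilt G.vPiece) (G.rhoLin x.1) g.toLinearMap) : g = G.expRho x :=
  LinearEquiv.toLinearMap_injective (hg.unique raiseFilt_isFiltration (G.isExp_expRho x))

theorem exists_isExp {n : ℕ} (hn : 1 ≤ n) :
    ∀ T ∈ G.opHat n, ∃ g, IsExp (raiseFilt G.vPiece) T g := by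
  rintro _ ⟨x, hx, rfl⟩
  exact ⟨_, G.isExp_expRho (G.incl hn ⟨x, hx⟩)⟩

/-- The exponentials of elements of `∏_{k ≥ n} g_k` are closed under multiplication. -/
theorem expRho_mul (hV : LieModule.IsFaithful ℂ (KMAlg R) V) {n : ℕ} (hn : 1 ≤ n)
    {x y : G.nHat 1} (hx : x.1 ∈ G.nHat n) (hy : y.1 ∈ G.nHat n) :
    ∃ z : G.nHat 1, z.1 ∈ G.nHat n ∧ G.expRho x * G.expRho y = G.expRho z := by
  obtain ⟨_, ⟨z, hz, rfl⟩, hzz⟩ := (G.isExp_expRho x).exists_mul raiseFilt_isFiltration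
    (G.opHat_isProLie hV hn) degOp_mem der_degOp_sub_mem (G.exists_isExp hn)
    ⟨x.1, hx, rfl⟩ ⟨y.1, hy, rfl⟩ (G.isExp_expRho y)
  exact ⟨G.incl hn ⟨z, hz⟩, hz, G.eq_expRho hzz⟩

theorem component_apply (x : G.nHat 1) (k j : ℤ) :
    (G.component x k).1.1 j = if j = k then x.1.1 j else 0 := rfl

theorem component_mem (x : G.nHat 1) (k : ℤ) : (G.component x k).1 ∈ G.nHat k :=
  fun j hj => by rw [component_apply, if_neg (by omega)]

theorem sub_component_mem {x : G.nHat 1} {k : ℕ} (hx : x.1 ∈ G.nHat k) :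
    x.1 - (G.component x k).1 ∈ G.nHat (k + 1 : ℕ) := by
  intro j hj
  change x.1.1 j - (G.component x k).1.1 j = 0
  rw [component_apply]
  split_ifs with h1
  · rw [sub_self]
  · rw [hx j (by push_cast at hj; omega), sub_zero]

theorem expRho_sub_mem {x y : G.nHat 1} {k : ℕ} (hxy : x.1 - y.1 ∈ G.nHat k) :
    (G.expRho x).toLinearMap - (G.expRho y).toLinearMap ∈ raiseFilt G.vPiece k :=
  (G.isExp_expRho x).sub_mem' raiseFilt_isFiltration (G.isExp_expRho y)
    (by rw [← rhoLin_sub]; exact G.rhoLin_mem hxy)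

theorem sub_mem_nHat (hV : LieModule.IsFaithful ℂ (KMAlg R) V) {x y : G.nHat 1} {k : ℕ}
    (hxy : (G.expRho x).toLinearMap - (G.expRho y).toLinearMap ∈ raiseFilt G.vPiece k) :
    x.1 - y.1 ∈ G.nHat k := by
  have := (G.isExp_expRho x).sub_mem_of_sub_mem raiseFilt_isFiltration (G.isExp_expRho y) hxy
  rw [← rhoLin_sub] at this
  exact G.mem_nHat_of_rhoLin_mem hV this

theorem expRho_zero : G.expRho 0 = 1 := by
  refine (G.eq_expRho ?_).symm
  have := isExp_zero (raiseFilt_isFiltration (W := G.vPiece))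
  rw [Submodule.coe_zero, map_zero]
  exact this

theorem expRho_neg_mul (x : G.nHat 1) : G.expRho (-x) * G.expRho x = 1 := by
  have h1 := G.isExp_expRho (-x)
  rw [Submodule.coe_neg, map_neg] at h1
  exact LinearEquiv.toLinearMap_injective
    ((G.isExp_expRho x).neg_mul raiseFilt_isFiltration h1)

theorem expRho_mul_neg (x : G.nHat 1) : G.expRho x * G.expRho (-x) = 1 := by
  have h1 : -(-x) = x := neg_neg (x : G.nHat 1)
  have := G.expRho_neg_mul (-x)
  rwa [h1] at this

/-- The factor of lowest degree can be split off on the right. -/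
theorem exists_expRho_eq_mul (hV : LieModule.IsFaithful ℂ (KMAlg R) V) {k : ℕ} (hk : 1 ≤ k)
    (z : G.nHat 1) (hz : z.1 ∈ G.nHat k) : ∃ z' : G.nHat 1, z'.1 ∈ G.nHat (k + 1 : ℕ) ∧
      G.expRho z = G.expRho z' * G.expRho (G.component z k) := by
  set u := G.component z k with hu
  have huk : u.1 ∈ G.nHat k := G.component_mem z k
  obtain ⟨z', hz', hzz⟩ := G.expRho_mul hV hk hz (y := -u) ((G.nHat k).neg_mem huk)
  refine ⟨z', ?_, ?_⟩
  · have h1 := G.expRho_sub_mem (G.sub_component_mem hz)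
    rw [← hu] at h1
    -- Multiplying `exp z - exp u`, which lies in step `k + 1`, by `exp (-u)` gives `exp z' - 1`.
    have h2 : (G.expRho z').toLinearMap - (G.expRho 0).toLinearMap ∈
        raiseFilt G.vPiece (k + 1) := by
      have h3 := raiseFilt_isFiltration.mul_mem h1
        ((G.isExp_expRho (-u)).mem_zero raiseFilt_isFiltration)
      rw [sub_mul] at h3
      have h4 : (G.expRho u).toLinearMap * (G.expRho (-u)).toLinearMap =
          (G.expRho 0).toLinearMap := by
        rw [expRho_zero, ← G.expRho_mul_neg u]; rfl
      rw [h4] at h3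
      rw [← hzz]
      exact h3
    have := G.sub_mem_nHat hV h2
    rwa [Submodule.coe_zero, sub_zero] at this
  · rw [← hzz, mul_assoc, expRho_neg_mul, mul_one]

/-! ### Infinite products -/

/-- With `c` the new component and `P` the old product, the difference is `(exp c - 1 - c) P + c (P
- 1)`, and each summand is one step deeper than `c`. -/
theorem partialProd_succ_sub_mem (n : ℕ) (x : G.nHat 1) (j : ℕ)
    (hP : (G.partialProd n x j).toLinearMap - 1 ∈ raiseFilt G.vPiece 1) :
    (G.partialProd n x (j + 1)).toLinearMap - (G.partialProd n x j).toLinearMap -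
      G.rhoLin (G.component x ((n + j : ℕ) : ℤ)).1 ∈ raiseFilt G.vPiece (n + j + 1) := by
  have hF := raiseFilt_isFiltration (W := G.vPiece)
  set c := G.component x ((n + j : ℕ) : ℤ) with hc
  have hcm : G.rhoLin c.1 ∈ raiseFilt G.vPiece (n + j) := G.rhoLin_mem (G.component_mem x _)
  have e : (G.partialProd n x (j + 1)).toLinearMap =
      (G.expRho c).toLinearMap * (G.partialProd n x j).toLinearMap := by
    rw [hc]; push_cast; rfl
  have hP0 : (G.partialProd n x j).toLinearMap ∈ raiseFilt G.vPiece 0 := by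
    have := add_mem (hF.anti zero_le_one hP) hF.one_mem
    rwa [sub_add_cancel] at this
  have h1 := (G.isExp_expRho c).sub_sub_mem hF (isExp_zero hF) (k := n + j)
    (by rwa [sub_zero])
  rw [sub_zero] at h1
  have e2 : (G.expRho c).toLinearMap * (G.partialProd n x j).toLinearMap -
      (G.partialProd n x j).toLinearMap - G.rhoLin c.1 =
      ((G.expRho c).toLinearMap - 1 - G.rhoLin c.1) * (G.partialProd n x j).toLinearMap +
        G.rhoLin c.1 * ((G.partialProd n x j).toLinearMap - 1) := by noncomm_ring
  rw [e, e2]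
  refine add_mem ?_ (hF.mul_mem hcm hP)
  simpa using hF.mul_mem h1 hP0

theorem exists_partialProd_eq (hV : LieModule.IsFaithful ℂ (KMAlg R) V) {n : ℕ} (hn : 1 ≤ n)
    (x : G.nHat 1) (j : ℕ) :
    ∃ z : G.nHat 1, z.1 ∈ G.nHat n ∧ G.partialProd n x j = G.expRho z := by
  induction j with
  | zero => exact ⟨0, (G.nHat n).zero_mem, G.expRho_zero.symm⟩
  | succ j ih =>
    obtain ⟨z, hz, hzz⟩ := ih
    rw [partialProd, hzz]
    exact G.expRho_mul hV hn (G.nHat_le (by omega) (G.component_mem x _)) hz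

theorem partialProd_sub_one_mem (hV : LieModule.IsFaithful ℂ (KMAlg R) V) {n : ℕ} (hn : 1 ≤ n)
    (x : G.nHat 1) (j : ℕ) : (G.partialProd n x j).toLinearMap - 1 ∈ raiseFilt G.vPiece 1 := by
  obtain ⟨z, -, hzz⟩ := G.exists_partialProd_eq hV hn x j
  rw [hzz]
  exact (G.isExp_expRho z).sub_one_mem

theorem partialProd_add_sub_mem (hV : LieModule.IsFaithful ℂ (KMAlg R) V) {n : ℕ} (hn : 1 ≤ n)
    (x : G.nHat 1) (j i : ℕ) :
    (G.partialProd n x (j + i)).toLinearMap - (G.partialProd n x j).toLinearMap ∈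
      raiseFilt G.vPiece (n + j) := by
  have hF := raiseFilt_isFiltration (W := G.vPiece)
  induction i with
  | zero => simp
  | succ i ih =>
    have h1 := hF.anti (by omega : n + j ≤ n + (j + i) + 1) (G.partialProd_succ_sub_mem n x
      (j + i) (G.partialProd_sub_one_mem hV hn x _))
    have h2 : G.rhoLin (G.component x ((n + (j + i) : ℕ) : ℤ)).1 ∈ raiseFilt G.vPiece (n + j) :=
      hF.anti (by omega : n + j ≤ n + (j + i)) (G.rhoLin_mem (G.component_mem x _))
    have := add_mem (add_mem h1 h2) ih
    rwa [sub_add_cancel, sub_add_sub_cancel] at this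

theorem exists_expRho_eq_prod (hV : LieModule.IsFaithful ℂ (KMAlg R) V) {n : ℕ} (hn : 1 ≤ n)
    (x : G.nHat 1) : ∃ z : G.nHat 1, z.1 ∈ G.nHat n ∧ ∀ j,
      (G.expRho z).toLinearMap - (G.partialProd n x j).toLinearMap ∈
        raiseFilt G.vPiece (n + j) := by
  have hF := raiseFilt_isFiltration (W := G.vPiece)
  choose z hz hzz using G.exists_partialProd_eq hV hn x
  obtain ⟨_, ⟨y, hy, rfl⟩, a, ha, haP⟩ := (G.opHat_isProLie hV hn).exists_isExp_limit hF
    (G.exists_isExp hn) (x := fun j => G.rhoLin (z j).1)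
    (g := fun j => (G.expRho (z j)).toLinearMap) (fun j => ⟨_, hz j, rfl⟩)
    (fun j => G.isExp_expRho (z j)) (fun j => by
      rw [← hzz, ← hzz]
      exact hF.anti (by omega) (G.partialProd_add_sub_mem hV hn x j 1))
  refine ⟨G.incl hn ⟨y, hy⟩, hy, fun j => ?_⟩
  have e : a = (G.expRho (G.incl hn ⟨y, hy⟩)).toLinearMap :=
    ha.unique hF (G.isExp_expRho (G.incl hn ⟨y, hy⟩))
  -- The limit is known only to depth `j` at stage `j`, so stage `j + n` is used and then compared
  -- with stage `j`.
  have h1 := hF.anti (by omega : n + j ≤ j + n) (haP (j + n))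
  rw [← hzz, e] at h1
  have := add_mem h1 (G.partialProd_add_sub_mem hV hn x j n)
  rwa [sub_add_sub_cancel] at this

theorem exists_prod_eq_expRho (hV : LieModule.IsFaithful ℂ (KMAlg R) V) {n : ℕ} (hn : 1 ≤ n)
    (z : G.nHat 1) (hz : z.1 ∈ G.nHat n) : ∃ x : G.nHat 1, x.1 ∈ G.nHat n ∧ ∀ j,
      (G.expRho z).toLinearMap - (G.partialProd n x j).toLinearMap ∈
        raiseFilt G.vPiece (n + j) := by
  have hF := raiseFilt_isFiltration (W := G.vPiece)
  have step : ∀ (k : ℕ) (z : G.nHat 1), 1 ≤ k → z.1 ∈ G.nHat k → ∃ z' : G.nHat 1,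
      z'.1 ∈ G.nHat (k + 1 : ℕ) ∧ G.expRho z = G.expRho z' * G.expRho (G.component z k) :=
    fun k z hk hz => G.exists_expRho_eq_mul hV hk z hz
  choose! Φ hΦ hΦe using step
  -- `Z j` is what remains after `j` factors have been split off; it starts in degree `n + j`, and
  -- the product sought takes its component of that degree.
  let Z : ℕ → G.nHat 1 := fun j => Nat.rec z (fun j w => Φ (n + j) w) j
  have hZ : ∀ j, (Z j).1 ∈ G.nHat (n + j : ℕ) := by
    intro j
    induction j with
    | zero => exact hz
    | succ j ih => exact hΦ (n + j) (Z j) (by omega) ih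
  have hZe : ∀ j, G.expRho (Z j) =
      G.expRho (Z (j + 1)) * G.expRho (G.component (Z j) (n + j : ℕ)) :=
    fun j => hΦe (n + j) (Z j) (by omega) (hZ j)
  let x : G.nHat 1 := ⟨⟨fun k => if k < n then 0 else (Z (k - n).toNat).1.1 k,
    n, fun k hk => if_pos hk⟩, fun k hk => if_pos (by omega)⟩
  have hx : ∀ k : ℤ, x.1.1 k = if k < n then 0 else (Z (k - n).toNat).1.1 k := fun _ => rfl
  have hcomp : ∀ j : ℕ, G.component x ((n : ℤ) + j) = G.component (Z j) (n + j : ℕ) := by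
    intro j
    apply Subtype.ext
    apply Subtype.ext
    funext k
    rw [component_apply, component_apply]
    push_cast
    split_ifs with hk
    · rw [hx, if_neg (by omega), show (k - n).toNat = j by omega]
    · rfl
  have hprod : ∀ j, G.expRho z = G.expRho (Z j) * G.partialProd n x j := by
    intro j
    induction j with
    | zero => rw [partialProd, mul_one]; rfl
    | succ j ih => rw [partialProd, hcomp, ← mul_assoc, ← hZe, ih]
  refine ⟨x, fun k hk => if_pos hk, fun j => ?_⟩
  have h1 : (G.expRho (Z j)).toLinearMap - 1 ∈ raiseFilt G.vPiece (n + j) := by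
    have := G.expRho_sub_mem (x := Z j) (y := 0) (k := n + j)
      (by rw [Submodule.coe_zero, sub_zero]; exact hZ j)
    rwa [expRho_zero] at this
  obtain ⟨w, -, hw⟩ := G.exists_partialProd_eq hV hn x j
  have h2 := hF.mul_mem h1 ((G.isExp_expRho w).mem_zero hF)
  rw [← hw, sub_mul, one_mul, add_zero] at h2
  rw [hprod j]
  exact h2

end StdGrading

end KacMoody

namespace KacMoody

open FilteredExp

/-! ### Topologies -/

section ModuleTopology

variable {U : Type*} [AddCommGroup U] [Module ℂ U] [TopologicalSpace U] [IsModuleTopology ℂ U]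

variable (U) in
-- Linear functionals are continuous for the module topology and separate points.
theorem t2Space_of_isModuleTopology : T2Space U := by
  refine T2Space.of_injective_continuous (f := fun (u : U) (φ : Module.Dual ℂ U) => φ u) ?_
    (continuous_pi fun φ => IsModuleTopology.continuous_of_linearMap φ)
  intro u v huv
  rw [← sub_eq_zero, ← Module.forall_dual_apply_eq_zero_iff ℂ]
  intro φ
  rw [map_sub, sub_eq_zero]
  exact congrFun huv φ

/-- A map to a finite-dimensional space is continuous if its compositions with the members of a
separating family of linear maps are. -/
theorem continuous_of_separating [Module.Finite ℂ U] {ι : Type*} {M : ι → Type*}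
    [∀ i, AddCommGroup (M i)] [∀ i, Module ℂ (M i)] [∀ i, TopologicalSpace (M i)]
    [∀ i, IsModuleTopology ℂ (M i)] (L : ∀ i, U →ₗ[ℂ] M i)
    (hL : ∀ u, (∀ i, L i u = 0) → u = 0) {X : Type*} [TopologicalSpace X] {f : X → U}
    (hf : ∀ i, Continuous fun t => L i (f t)) : Continuous f := by
  -- The functionals whose composition with `f` is continuous form a subspace containing all `ψ ∘ L
  -- i`. Its common kernel is zero, so in finite dimension it is the whole dual.
  let S : Submodule ℂ (Module.Dual ℂ U) :=
    { carrier := {φ | Continuous fun t => φ (f t)}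
      add_mem' := fun hφ hψ => Continuous.add (M := ℂ) hφ hψ
      zero_mem' := continuous_const
      smul_mem' := fun c _ hφ => Continuous.const_smul (α := ℂ) hφ c }
  have hS : S = ⊤ := by
    rw [← Subspace.dualCoannihilator_dualAnnihilator_eq (W := S)]
    have : S.dualCoannihilator = ⊥ := by
      rw [eq_bot_iff]
      intro u hu
      rw [Submodule.mem_dualCoannihilator] at hu
      refine (Submodule.mem_bot ℂ).mpr (hL u fun i => ?_)
      rw [← Module.forall_dual_apply_eq_zero_iff ℂ]
      intro ψ
      exact hu (ψ ∘ₗ L i) ((IsModuleTopology.continuous_of_linearMap (R := ℂ) ψ).comp (hf i))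
    rw [this, Submodule.dualAnnihilator_bot]
  have := IsModuleTopology.toContinuousSMul ℂ U
  have := IsModuleTopology.toContinuousAdd ℂ U
  let b := Module.finBasis ℂ U
  have e : f = fun t => ∑ i, b.coord i (f t) • b i := by
    funext t
    exact (b.sum_repr (f t)).symm
  rw [e]
  refine continuous_finsetSum _ fun i _ => Continuous.smul ?_ continuous_const
  exact (hS ▸ Submodule.mem_top : b.coord i ∈ S)

end ModuleTopology

/-! ### Continuity and triangular maps on the completions. -/

namespace StdGrading

variable {l : ℕ} {A : Matrix (Fin l) (Fin l) ℤ} {h : Type*} [AddCommGroup h] [Module ℂ h]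
  {R : Realization A h} {V : Type*} [AddCommGroup V] [Module ℂ V]
  [LieRingModule (KMAlg R) V] [LieModule ℂ (KMAlg R) V]
  {P : AddSubgroup (Module.Dual ℂ h)} (G : StdGrading R V P)

noncomputable instance gPieceTopology (m : ℤ) : TopologicalSpace (G.gPiece m) :=
  moduleTopology ℂ (G.gPiece m)

instance (m : ℤ) : IsModuleTopology ℂ (G.gPiece m) := ⟨rfl⟩

noncomputable instance vPieceTopology (m : ℤ) : TopologicalSpace (G.vPiece m) :=
  moduleTopology ℂ (G.vPiece m)

instance (m : ℤ) : IsModuleTopology ℂ (G.vPiece m) := ⟨rfl⟩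

instance (m : ℤ) : ContinuousAdd (G.vPiece m) := IsModuleTopology.toContinuousAdd ℂ _

instance (m : ℤ) : ContinuousSMul ℂ (G.vPiece m) := IsModuleTopology.toContinuousSMul ℂ _

instance (m : ℤ) : IsTopologicalAddGroup (G.vPiece m) :=
  IsModuleTopology.topologicalAddGroup ℂ _

variable {G} {X : Type*} [TopologicalSpace X]

theorem continuous_vHat_iff {w : X → G.vHat} :
    Continuous w ↔ ∀ m, Continuous fun t => (w t).1 m :=
  continuous_induced_rng.trans continuous_pi_iff

theorem continuous_gHat_iff {x : X → G.gHat} :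
    Continuous x ↔ ∀ m, Continuous fun t => (x t).1 m :=
  continuous_induced_rng.trans continuous_pi_iff

theorem continuous_nHat_iff {n : ℤ} {x : X → G.nHat n} :
    Continuous x ↔ ∀ m, Continuous fun t => (x t).1.1 m :=
  continuous_induced_rng.trans continuous_gHat_iff

theorem continuous_gl_iff {Φ : X → (G.vHat ≃ₗ[ℂ] G.vHat)} :
    Continuous Φ ↔ ∀ v, Continuous fun t => Φ t v :=
  continuous_induced_rng.trans continuous_pi_iff

variable (G)

theorem t2Space_vHat : T2Space G.vHat := by
  have := fun m => t2Space_of_isModuleTopology (G.vPiece m)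
  exact T2Space.of_injective_continuous (f := fun v : G.vHat => fun m => v.1 m)
    Subtype.val_injective (continuous_pi fun m => continuous_vHat_iff.mp continuous_id m)

theorem t2Space_gl : T2Space (G.vHat ≃ₗ[ℂ] G.vHat) := by
  have := G.t2Space_vHat
  exact T2Space.of_injective_continuous (f := fun (g : G.vHat ≃ₗ[ℂ] G.vHat) v => g v)
    DFunLike.coe_injective (continuous_pi fun v => continuous_gl_iff.mp continuous_id v)

/-- Convergence for the filtration implies pointwise convergence. -/
theorem tendsto_of_mem_raiseFilt {g : ℕ → (G.vHat ≃ₗ[ℂ] G.vHat)} {a : G.vHat ≃ₗ[ℂ] G.vHat}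
    (hg : ∀ j, a.toLinearMap - (g j).toLinearMap ∈ raiseFilt G.vPiece j) :
    Tendsto g atTop (𝓝 a) := by
  rw [nhds_induced, tendsto_comap_iff, tendsto_pi_nhds]
  intro v
  rw [nhds_induced, tendsto_comap_iff, tendsto_pi_nhds]
  intro m
  obtain ⟨N, hN⟩ := v.2
  refine tendsto_nhds_of_eventually_eq ?_
  filter_upwards [eventually_ge_atTop (m - N + 1).toNat] with j hj
  exact (sub_eq_zero.mp (hg j N v hN m (by omega))).symm

/-- The action `g_k × V_{m-k} → V_m`. -/
noncomputable def act (k m : ℤ) : G.gPiece k →ₗ[ℂ] G.vPiece (m - k) →ₗ[ℂ] G.vPiece m :=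
  LinearMap.mk₂ ℂ (fun x v => ⟨⁅(x : KMAlg R), (v : V)⁆, by
      have := G.lie_mem_vPiece x.2 v.2
      rwa [add_sub_cancel] at this⟩)
    (fun _ _ _ => Subtype.ext (add_lie _ _ _)) (fun _ _ _ => Subtype.ext (smul_lie _ _ _))
    (fun _ _ _ => Subtype.ext (lie_add _ _ _)) (fun _ _ _ => Subtype.ext (lie_smul _ _ _))

theorem rhoHat_eq_sum_act {x : G.gHat} {v : G.vHat} {N : ℤ} (hx : x ∈ G.nHat 1)
    (hv : OrdGE N v) (m : ℤ) :
    (G.rhoHat x v).1 m = ∑ k ∈ Finset.Icc 1 (m - N), G.act k m (x.1 k) (v.1 (m - k)) := by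
  apply Subtype.ext
  rw [rhoHat_apply, Submodule.coe_sum, finsum_eq_sum_of_support_subset]
  · rfl
  · intro k hk
    by_contra hlt
    refine hk ?_
    rw [Finset.coe_Icc, Set.mem_Icc, not_and_or] at hlt
    rcases hlt with h1 | h1
    · simp [hx k (by omega)]
    · simp [hv (m - k) (by omega)]

variable {G}

/-- The common lower bound `N` on the orders makes the range of summation independent of `t`. -/
theorem continuous_rhoHat {x : X → G.gHat} {w : X → G.vHat} {N : ℤ} (hx : Continuous x)
    (hx1 : ∀ t, x t ∈ G.nHat 1) (hw : Continuous w) (hwN : ∀ t, OrdGE N (w t)) :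
    Continuous fun t => G.rhoHat (x t) (w t) := by
  have := G.vPiece_finite
  rw [continuous_vHat_iff] at hw ⊢
  rw [continuous_gHat_iff] at hx
  intro m
  simp only [fun t => G.rhoHat_eq_sum_act (hx1 t) (hwN t) m]
  exact continuous_finsetSum _ fun k _ =>
    (IsModuleTopology.continuous_bilinear_of_finite_right (R := ℂ) (G.act k m)).comp
      ((hx k).prodMk (hw (m - k)))

theorem continuous_expRho_apply {x : X → G.nHat 1} {w : X → G.vHat} {N : ℤ} (hx : Continuous x)
    (hw : Continuous w) (hwN : ∀ t, OrdGE N (w t)) :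
    Continuous fun t => G.expRho (x t) (w t) := by
  have hpow : ∀ j : ℕ, Continuous fun t => (G.rhoHat (x t).1 ^ j) (w t) := by
    intro j
    induction j with
    | zero => simpa using hw
    | succ j ih =>
      simp only [pow_succ', Module.End.mul_apply]
      exact continuous_rhoHat (N := N) (continuous_subtype_val.comp hx) (fun t => (x t).2) ih
        fun t => ((G.rhoHat_raises (x t)).pow (hwN t) j).mono (by omega)
  rw [continuous_vHat_iff]
  intro m
  have e : ∀ t, (G.expRho (x t) (w t)).1 m = ∑ j ∈ Finset.range (m - N + 1).toNat,
      ((j.factorial : ℂ))⁻¹ • ((G.rhoHat (x t).1 ^ j) (w t)).1 m := by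
    intro t
    have h1 := proSeries_ordGE_sub (fun j => ((j.factorial : ℂ))⁻¹) _ (G.rhoHat_raises (x t))
      (hwN t) (m - N + 1).toNat m (by omega)
    have h2 := sub_eq_zero.mp h1
    refine h2.trans ?_
    simp
  simp only [e]
  exact continuous_finsetSum _ fun j _ => 
    (continuous_const_smul (T := G.vPiece m) ((j.factorial : ℂ))⁻¹).comp
      (continuous_vHat_iff.mp (hpow j) m)

theorem continuous_expRho {x : X → G.nHat 1} (hx : Continuous x) :
    Continuous fun t => G.expRho (x t) := by
  rw [continuous_gl_iff]
  intro v
  obtain ⟨N, hN⟩ := v.2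
  exact continuous_expRho_apply hx continuous_const fun _ => hN

theorem continuous_component {x : X → G.nHat 1} (hx : Continuous x) (k : ℤ) :
    Continuous fun t => G.component (x t) k := by
  rw [continuous_nHat_iff] at hx ⊢
  intro m
  simp only [component_apply]
  split_ifs
  · exact hx m
  · exact continuous_const

theorem continuous_partialProd_apply (hV : LieModule.IsFaithful ℂ (KMAlg R) V) {n : ℕ}
    (hn : 1 ≤ n) {x : X → G.nHat 1} (hx : Continuous x) {N : ℤ} {v : G.vHat} (hv : OrdGE N v)
    (j : ℕ) : Continuous fun t => G.partialProd n (x t) j v := by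
  induction j with
  | zero => exact continuous_const
  | succ j ih =>
    refine continuous_expRho_apply (N := N) (continuous_component hx ((n : ℤ) + j)) ih fun t => ?_
    -- A partial product is an exponential, hence does not lower the order, so the bound `N`
    -- persists.
    obtain ⟨z, -, hz⟩ := G.exists_partialProd_eq hV hn (x t) j
    rw [hz]
    simpa using (G.isExp_expRho z).mem_zero raiseFilt_isFiltration N v hv

variable (G)

/-- The components of degree less than `k`. -/
noncomputable def trunc (k : ℕ) {n : ℕ} (x : G.nHat n) : G.nHat n :=
  ⟨⟨fun i => if i < k then x.1.1 i else 0, n, fun i hi => by simp [x.2 i hi]⟩,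
    fun i hi => by
      change (if i < k then x.1.1 i else 0) = 0
      rw [x.2 i hi, ite_self]⟩

theorem trunc_apply (k : ℕ) {n : ℕ} (x : G.nHat n) (i : ℤ) :
    (G.trunc k x).1.1 i = if i < k then x.1.1 i else 0 := rfl

theorem sub_trunc_mem (k : ℕ) {n : ℕ} (x : G.nHat n) :
    x.1 - (G.trunc k x).1 ∈ G.nHat k := by
  intro i hi
  change x.1.1 i - (G.trunc k x).1.1 i = 0
  rw [trunc_apply, if_pos hi, sub_self]

theorem eq_zero_of_act (hV : LieModule.IsFaithful ℂ (KMAlg R) V) {k : ℤ} {u : G.gPiece k}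
    (hu : ∀ p : Σ m : ℤ, G.vPiece (m - k), G.act k p.1 u p.2 = 0) : u = 0 := by
  have h1 : ⨆ m, G.vPiece m ≤ LinearMap.ker (LieModule.toEnd ℂ (KMAlg R) V (u : KMAlg R)) := by
    refine iSup_le fun m v hv => ?_
    exact congrArg Subtype.val (hu ⟨m + k, v, by rwa [add_sub_cancel_right]⟩)
  rw [iSup_vPiece] at h1
  refine Subtype.ext (hV.injective_toEnd ?_)
  rw [Submodule.coe_zero, map_zero]
  ext v
  exact h1 (Submodule.mem_top (x := v))

/-- A continuous triangular map from `∏_{k ≥ n} g_k` is a homeomorphism onto its image. -/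
theorem exists_homeomorph_of_triangular (hV : LieModule.IsFaithful ℂ (KMAlg R) V) {n : ℕ}
    (hn : 1 ≤ n) {S : Set (G.vHat ≃ₗ[ℂ] G.vHat)} {Φ : G.nHat n → (G.vHat ≃ₗ[ℂ] G.vHat)}
    (hΦ : Continuous Φ) (hS : Set.range Φ = S)
    (htri : ∀ (x : G.nHat n) (k : ℕ), (Φ x).toLinearMap - (Φ (G.trunc k x)).toLinearMap -
      G.rhoLin (G.component (G.incl hn x) k).1 ∈ raiseFilt G.vPiece (k + 1)) :
    ∃ e : G.nHat n ≃ₜ S, ∀ x, (e x : G.vHat ≃ₗ[ℂ] G.vHat) = Φ x := by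
  -- Applied to a vector in degree `m - k`, the error term starts in degree `m + 1`, so the formula
  -- is exact in degree `m`.
  have hact : ∀ (x : G.nHat n) (k : ℕ) (p : Σ m : ℤ, G.vPiece (m - k)),
      G.act k p.1 (x.1.1 k) p.2 =
        (Φ x (single _ p.2)).1 p.1 - (Φ (G.trunc k x) (single _ p.2)).1 p.1 := by
    rintro x k ⟨m, v⟩
    have h1 := htri x k _ _ (single_ordGE _ v) m (by push_cast; omega)
    have h2 := sub_eq_zero.mp h1
    refine Eq.trans (Subtype.ext ?_) h2.symm
    rw [rhoLin_apply, rhoHat_apply, finsum_eq_single _ (k : ℤ)]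
    · rw [single_same, component_apply, if_pos rfl]
      rfl
    · intro i hi
      rw [component_apply, if_neg hi]
      simp
  have hinj : Function.Injective Φ := by
    intro x y hxy
    have key : ∀ k : ℕ, ∀ i : ℤ, i < k → x.1.1 i = y.1.1 i := by
      intro k
      induction k with
      | zero =>
        intro i hi
        rw [x.2 i (by omega), y.2 i (by omega)]
      | succ k ih =>
        intro i hi
        rcases (show i ≤ k by omega).lt_or_eq with h | rfl
        · exact ih i h
        · have ht : G.trunc k x = G.trunc k y := by
            apply Subtype.ext
            apply Subtype.ext
            funext i
            rw [trunc_apply, trunc_apply]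
            split_ifs with h
            · exact ih i h
            · rfl
          refine sub_eq_zero.mp (G.eq_zero_of_act hV fun p => ?_)
          rw [map_sub, LinearMap.sub_apply, hact, hact, hxy, ht, sub_self]
    apply Subtype.ext
    apply Subtype.ext
    funext i
    exact key (i + 1).toNat i (by omega)
  let e : G.nHat n ≃ S := (Equiv.ofInjective Φ hinj).trans (Equiv.setCongr hS)
  have he : ∀ x, (e x : G.vHat ≃ₗ[ℂ] G.vHat) = Φ x := fun _ => rfl
  have hes : ∀ g, Φ (e.symm g) = g := fun g => by rw [← he, e.apply_symm_apply]
  have hsymm : Continuous e.symm := by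
    rw [continuous_nHat_iff]
    -- By induction the truncation below `k` depends continuously on `g`. Then `hact` makes the
    -- action of `x_k` continuous in `g`, and these actions separate the points of the
    -- finite-dimensional `g_k`.
    have key : ∀ k : ℕ, ∀ i : ℤ, i < k → Continuous fun g => (e.symm g).1.1 i := by
      intro k
      induction k with
      | zero =>
        intro i hi
        have : ∀ g, (e.symm g).1.1 i = 0 := fun g => (e.symm g).2 i (by omega)
        simp only [this]
        exact continuous_const
      | succ k ih =>
        intro i hi
        rcases (show i ≤ k by omega).lt_or_eq with h | rfl
        · exact ih i h
        · have ht : Continuous fun g => G.trunc k (e.symm g) := by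
            rw [continuous_nHat_iff]
            intro i
            simp only [trunc_apply]
            split_ifs with h
            · exact ih i h
            · exact continuous_const
          have := G.gPiece_finite k
          refine continuous_of_separating
            (L := fun p : Σ m : ℤ, G.vPiece (m - k) => (G.act k p.1).flip p.2)
            (fun u hu => G.eq_zero_of_act hV hu) fun p => ?_
          simp only [LinearMap.flip_apply, hact, hes]
          refine Continuous.sub ?_ ?_
          · exact continuous_vHat_iff.mp
              (continuous_gl_iff.mp continuous_subtype_val (single _ p.2)) p.1
          · exact continuous_vHat_iff.mp
              (continuous_gl_iff.mp (hΦ.comp ht) (single _ p.2)) p.1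
    exact fun m => key (m + 1).toNat m (by omega)
  exact ⟨⟨e, hΦ.subtype_mk _, hsymm⟩, he⟩

/-! ### The exponential and the infinite product as triangular maps. -/

theorem continuous_incl {n : ℕ} (hn : 1 ≤ n) : Continuous (G.incl hn) := by
  rw [continuous_nHat_iff]
  exact (continuous_nHat_iff (G := G) (n := n) (x := id)).mp continuous_id

theorem isInfProd_of_mem {n : ℕ} {x : G.nHat 1} {g : G.vHat ≃ₗ[ℂ] G.vHat}
    (hg : ∀ j, g.toLinearMap - (G.partialProd n x j).toLinearMap ∈ raiseFilt G.vPiece (n + j)) :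
    G.IsInfProd n x g :=
  G.tendsto_of_mem_raiseFilt fun j => raiseFilt_isFiltration.anti (by omega) (hg j)

theorem range_expRho (hV : LieModule.IsFaithful ℂ (KMAlg R) V) {n : ℕ} (hn : 1 ≤ n) :
    Set.range (fun x => G.expRho (G.incl hn x)) = G.UHat hn := by
  have := G.t2Space_gl
  ext g
  constructor
  · rintro ⟨z, rfl⟩
    obtain ⟨x, hx, hxz⟩ := G.exists_prod_eq_expRho hV hn (G.incl hn z) z.2
    exact ⟨⟨x.1, hx⟩, G.isInfProd_of_mem hxz⟩
  · rintro ⟨x, hx⟩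
    obtain ⟨z, hz, hxz⟩ := G.exists_expRho_eq_prod hV hn (G.incl hn x)
    exact ⟨⟨z.1, hz⟩, tendsto_nhds_unique (G.isInfProd_of_mem hxz) hx⟩

theorem expRho_triangular {n : ℕ} (hn : 1 ≤ n) (x : G.nHat n) (k : ℕ) :
    (G.expRho (G.incl hn x)).toLinearMap - (G.expRho (G.incl hn (G.trunc k x))).toLinearMap -
      G.rhoLin (G.component (G.incl hn x) k).1 ∈ raiseFilt G.vPiece (k + 1) := by
  have h1 := (G.isExp_expRho (G.incl hn x)).sub_sub_mem raiseFilt_isFiltration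
    (G.isExp_expRho (G.incl hn (G.trunc k x))) (k := k)
    (by rw [← rhoLin_sub]; exact G.rhoLin_mem (G.sub_trunc_mem k x))
  have h2 : x.1 - (G.trunc k x).1 - (G.component (G.incl hn x) k).1 ∈ G.nHat (k + 1 : ℕ) := by
    intro i hi
    change x.1.1 i - (G.trunc k x).1.1 i - (G.component (G.incl hn x) k).1.1 i = 0
    rw [trunc_apply, component_apply]
    split_ifs with h3 h4 h4
    · omega
    · rw [sub_self, sub_zero]
    · rw [sub_zero]
      exact sub_self _
    · push_cast at hi
      omega
  have := add_mem h1 (G.rhoLin_mem h2)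
  rw [rhoLin_sub, rhoLin_sub] at this
  convert this using 1
  change _ = _ - _ - (G.rhoLin x.1 - G.rhoLin (G.trunc k x).1) + _
  abel

theorem partialProd_trunc {n : ℕ} (hn : 1 ≤ n) (x : G.nHat n) {k j : ℕ} (hj : n + j ≤ k) :
    G.partialProd n (G.incl hn (G.trunc k x)) j = G.partialProd n (G.incl hn x) j := by
  induction j with
  | zero => rfl
  | succ j ih =>
    rw [partialProd, partialProd, ih (by omega)]
    congr 2
    apply Subtype.ext
    apply Subtype.ext
    funext i
    rw [component_apply, component_apply]
    split_ifs with h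
    · exact if_pos (by omega)
    · rfl

/-- For `k < n` nothing of degree `k` occurs, and both products are 1 modulo step `n`. For `k = n +
j`, the products for `x` and its truncation share their first `j` factors, and the next factor
contributes `ρ(x_k)` for `x` and nothing for the truncation. -/
theorem prod_triangular (hV : LieModule.IsFaithful ℂ (KMAlg R) V) {n : ℕ} (hn : 1 ≤ n)
    {Φ : G.nHat n → (G.vHat ≃ₗ[ℂ] G.vHat)}
    (hΦ : ∀ x j, (Φ x).toLinearMap - (G.partialProd n (G.incl hn x) j).toLinearMap ∈
      raiseFilt G.vPiece (n + j)) (x : G.nHat n) (k : ℕ) :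
    (Φ x).toLinearMap - (Φ (G.trunc k x)).toLinearMap -
      G.rhoLin (G.component (G.incl hn x) k).1 ∈ raiseFilt G.vPiece (k + 1) := by
  have hF := raiseFilt_isFiltration (W := G.vPiece)
  have hzero : ∀ y : G.nHat n, y.1.1 k = 0 → G.rhoLin (G.component (G.incl hn y) k).1 = 0 := by
    intro y hy
    have : (G.component (G.incl hn y) k).1 = 0 := by
      apply Subtype.ext
      funext i
      rw [component_apply]
      split_ifs with h
      · rw [h]; exact hy
      · rfl
    rw [this, map_zero]
  rcases lt_or_ge k n with hk | hk
  · rw [hzero x (x.2 k (by exact_mod_cast hk)), sub_zero]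
    have := sub_mem (hΦ x 0) (hΦ (G.trunc k x) 0)
    rw [partialProd, partialProd, sub_sub_sub_cancel_right] at this
    exact hF.anti (by omega) this
  · obtain ⟨j, rfl⟩ := Nat.exists_eq_add_of_le hk
    have h1 := G.partialProd_succ_sub_mem n (G.incl hn x) j (G.partialProd_sub_one_mem hV hn _ j)
    have h2 := G.partialProd_succ_sub_mem n (G.incl hn (G.trunc (n + j) x)) j
      (G.partialProd_sub_one_mem hV hn _ j)
    rw [hzero _ (by rw [trunc_apply, if_neg (lt_irrefl _)]), sub_zero,
      G.partialProd_trunc hn x le_rfl] at h2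
    have h3 := sub_mem (add_mem (hΦ x (j + 1)) h1) (add_mem (hΦ (G.trunc (n + j) x) (j + 1)) h2)
    have e : ∀ a b c p q r : Module.End ℂ (PosCompletion G.vPiece),
        a - b - c = a - p + (p - q - c) - (b - r + (r - q)) := by
      intro a b c p q r
      abel
    rwa [← e] at h3

theorem exists_prod_homeomorph (hV : LieModule.IsFaithful ℂ (KMAlg R) V) {n : ℕ} (hn : 1 ≤ n) :
    ∃ e : G.nHat n ≃ₜ G.UHat hn, ∀ x, G.IsInfProd n (G.incl hn x) (e x) := by
  have := G.t2Space_gl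
  choose z hz hzP using fun x : G.nHat n => G.exists_expRho_eq_prod hV hn (G.incl hn x)
  have hprod : ∀ x, G.IsInfProd n (G.incl hn x) (G.expRho (z x)) :=
    fun x => G.isInfProd_of_mem (hzP x)
  obtain ⟨e, he⟩ := G.exists_homeomorph_of_triangular hV hn (S := G.UHat hn)
    (Φ := fun x => G.expRho (z x)) (by
      rw [continuous_gl_iff]
      intro v
      rw [continuous_vHat_iff]
      intro m
      obtain ⟨N, hN⟩ := v.2
      -- In degree `m`, factors beyond the first `m - N + 1` have no effect, so continuity reduces
      -- to a finite product whose length does not depend on `x`.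
      have e : ∀ x, (G.expRho (z x) v).1 m =
          (G.partialProd n (G.incl hn x) (m - N + 1).toNat v).1 m :=
        fun x => sub_eq_zero.mp (hzP x (m - N + 1).toNat N v hN m (by omega))
      simp only [e]
      exact continuous_vHat_iff.mp
        (continuous_partialProd_apply hV hn (G.continuous_incl hn) hN _) m)
    (by
      ext g
      constructor
      · rintro ⟨x, rfl⟩
        exact ⟨x, hprod x⟩
      · rintro ⟨x, hx⟩
        exact ⟨x, tendsto_nhds_unique (hprod x) hx⟩)
    (G.prod_triangular hV hn hzP)
  exact ⟨e, fun x => by rw [he]; exact hprod x⟩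

end StdGrading

end KacMoody

theorem mainTheorem12 {l : ℕ} {A : Matrix (Fin l) (Fin l) ℤ}
    (hA : IsGCM A) (hsym : IsSymmetrizable A)
    {h : Type*} [AddCommGroup h] [Module ℂ h] (R : Realization A h)
    (P : AddSubgroup (Module.Dual ℂ h)) (hP : KacMoody.IsRestrictedWeightLattice R P)
    (V : Type*) [AddCommGroup V] [Module ℂ V]
    [LieRingModule (KacMoody.KMAlg R) V] [LieModule ℂ (KacMoody.KMAlg R) V]
    (G : KacMoody.StdGrading R V P)
    (hV : LieModule.IsFaithful ℂ (KacMoody.KMAlg R) V)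
    (n : ℕ) (hn : 1 ≤ n) :
    (∃ e : G.nHat n ≃ₜ G.UHat hn, ∀ x, (e x : G.vHat ≃ₗ[ℂ] G.vHat) = G.expRho (G.incl hn x)) ∧
    (∃ e : G.nHat n ≃ₜ G.UHat hn, ∀ x, G.IsInfProd n (G.incl hn x) (e x)) :=
  ⟨G.exists_homeomorph_of_triangular hV hn
      (KacMoody.StdGrading.continuous_expRho (G.continuous_incl hn)) (G.range_expRho hV hn)
      (G.expRho_triangular hn),
    G.exists_prod_homeomorph hV hn⟩
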